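/- Let $(\omega,c)\in\mathbb R^2$ satisfy $\omega>c^2/4$, or $\omega=c^2/4$ and $c>0$. Let $\Phi_{\omega,c}>0$ be the soliton profile on $\mathbb R$ given by $$\Phi_{\omega,c}(x)^2=\frac{4\omega-c^2}{\sqrt\omega\left(\cosh(\sqrt{4\omega-c^2}\,x)-\frac{c}{2\sqrt\omega}\right)}\ \text{ if }\omega>\frac{c^2}{4},\qquad \Phi_{\omega,c}(x)^2=\frac{4c}{(cx)^2+1}\ \text{ if }\omega=\frac{c^2}{4},\ c>0.$$ Put $A(x)=64\omega-3x^2+8cx$, $\alpha_0=\frac13\left(4c+\sqrt{48\omega+4c^2}\right)$, $\alpha_1=4\sqrt\omega+2c$ and $L_0=2\pi/\sqrt{\alpha_0\sqrt{A(\alpha_0)}}$. For $\eta_3\in(\alpha_0,\alpha_1)$ put $$\eta_1=\frac{-\eta_3+4c-\sqrt{A(\eta_3)}}2,\quad \eta_2=\frac{-\eta_3+4c+\sqrt{A(\eta_3)}}2,\quad k^2=\frac{-\eta_1(\eta_3-\eta_2)}{\eta_3(\eta_2-\eta_1)},\quad g=\frac{2}{\sqrt{\eta_3(\eta_2-\eta_1)}},\quad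 \beta^2=-\frac{\eta_3k^2}{\eta_1},$$ with $k>0$, and let $T(\eta_3)=4gK(k)$, where $K(k)=\int_0^{\pi/2}(1-k^2\sin^2\theta)^{-1/2}\,d\theta$. Then for every $L>L_0$ there is exactly one $\eta_3=\eta_3(L)\in(\alpha_0,\alpha_1)$ with $T(\eta_3)=2L$, so that the $2L$-periodic wave profile $\Phi^L_{\omega,c}>0$ is well defined by $$\Phi^L_{\omega,c}(x)^2=\eta_3\,\frac{\mathrm{dn}^2\left(\frac{x}{2g};k\right)}{1+\beta^2\,\mathrm{sn}^2\left(\frac{x}{2g};k\right)},$$ where $\mathrm{sn},\mathrm{dn}$ are the Jacobi elliptic functions of modulus $k$ and $\eta_3=\eta_3(L)$. Moreover, for every integer $m\ge0$, $$\lim_{L\to\infty}\left\|\Phi^L_{\omega,c}-\Phi_{\omega,c}\right\|_{H^m([-L,L])}=0.$$ -/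

import Mathlib

open Set Filter Topology MeasureTheory
open scoped ENNReal

namespace DNLS

noncomputable section

/-! ### Elliptic integrals and Jacobi elliptic functions -/

/-- The incomplete elliptic integral of the first kind `F(φ, k)`. -/
def ellipticF (k φ : ℝ) : ℝ :=
  ∫ θ in (0 : ℝ)..φ, 1 / Real.sqrt (1 - k ^ 2 * Real.sin θ ^ 2)

/-- The complete elliptic integral of the first kind `K(k) = F(π / 2, k)`. -/
def ellipticK (k : ℝ) : ℝ := ellipticF k (Real.pi / 2)

/-- The amplitude: the inverse function of `F(·, k)`, which is a bijection of `ℝ` for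
`0 < k < 1`. -/
def jacobiAm (k : ℝ) : ℝ → ℝ := Function.invFun (ellipticF k)

/-- The Jacobi elliptic function `sn(u; k)`. -/
def jacobiSn (u k : ℝ) : ℝ := Real.sin (jacobiAm k u)

/-- The Jacobi elliptic function `dn(u; k)`. -/
def jacobiDn (u k : ℝ) : ℝ := Real.sqrt (1 - k ^ 2 * jacobiSn u k ^ 2)

/-! ### The solitons on the line -/

/-- The admissible parameters: `ω > c² / 4`, or `ω = c² / 4` and `c > 0`. -/
def Admissible (ω c : ℝ) : Prop :=
  c ^ 2 / 4 < ω ∨ (ω = c ^ 2 / 4 ∧ 0 < c)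

/-- The square of the soliton profile. -/
def solitonSq (ω c x : ℝ) : ℝ :=
  if c ^ 2 / 4 < ω then
    (4 * ω - c ^ 2) /
      (Real.sqrt ω * (Real.cosh (Real.sqrt (4 * ω - c ^ 2) * x) - c / (2 * Real.sqrt ω)))
  else 4 * c / ((c * x) ^ 2 + 1)

/-- The (positive) soliton profile `Φ_{ω,c}`. -/
def soliton (ω c x : ℝ) : ℝ := Real.sqrt (solitonSq ω c x)

/-! ### The parameters of the periodic waves

All of them are functions of `(ω, c)` and of `η₃`, the maximum of the squared profile. -/

/-- `A(x) = 64 ω - 3 x² + 8 c x`. -/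
def discA (ω c x : ℝ) : ℝ := 64 * ω - 3 * x ^ 2 + 8 * c * x

/-- The root `η₁` (the negative one). -/
def eta1 (ω c η₃ : ℝ) : ℝ := (-η₃ + 4 * c - Real.sqrt (discA ω c η₃)) / 2

/-- The root `η₂`, the minimum of the squared profile. -/
def eta2 (ω c η₃ : ℝ) : ℝ := (-η₃ + 4 * c + Real.sqrt (discA ω c η₃)) / 2

/-- `k² = -η₁ (η₃ - η₂) / (η₃ (η₂ - η₁))`. -/
def modulusSq (ω c η₃ : ℝ) : ℝ :=
  -eta1 ω c η₃ * (η₃ - eta2 ω c η₃) / (η₃ * (eta2 ω c η₃ - eta1 ω c η₃))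

/-- The modulus `k`. -/
def modulus (ω c η₃ : ℝ) : ℝ := Real.sqrt (modulusSq ω c η₃)

/-- `g = 2 / √(η₃ (η₂ - η₁))`. -/
def paramG (ω c η₃ : ℝ) : ℝ := 2 / Real.sqrt (η₃ * (eta2 ω c η₃ - eta1 ω c η₃))

/-- `β² = -η₃ k² / η₁`. -/
def betaSq (ω c η₃ : ℝ) : ℝ := -η₃ * modulusSq ω c η₃ / eta1 ω c η₃

/-- The fundamental period `4 g K(k)` of the wave with maximal squared value `η₃`. -/
def period (ω c η₃ : ℝ) : ℝ := 4 * paramG ω c η₃ * ellipticK (modulus ω c η₃)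

/-- `α₀`, the value of `η₃` for which `η₂ = η₃`. -/
def alpha0 (ω c : ℝ) : ℝ := (4 * c + Real.sqrt (48 * ω + 4 * c ^ 2)) / 3

/-- `α₁`, the value of `η₃` for which `η₂ = 0`. -/
def alpha1 (ω c : ℝ) : ℝ := 4 * Real.sqrt ω + 2 * c

/-- The threshold half-period `L₀ = 2π / √(α₀ √(A(α₀)))`. -/
def thresholdL (ω c : ℝ) : ℝ :=
  2 * Real.pi / Real.sqrt (alpha0 ω c * Real.sqrt (discA ω c (alpha0 ω c)))

/-- `η₃` is the maximal squared value of the single-bump wave on the torus of length `2L`: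
it lies in `(α₀, α₁)` and the fundamental period of the wave equals `2L`. -/
def IsMaxValue (ω c L η₃ : ℝ) : Prop :=
  alpha0 ω c < η₃ ∧ η₃ < alpha1 ω c ∧ period ω c η₃ = 2 * L

/-- The parameter `η₃` as a function of `(ω, c, L)`. -/
def eta3 (ω c L : ℝ) : ℝ := Classical.epsilon (IsMaxValue ω c L)

/-- The square of the periodic wave profile with parameter `η₃`:
`η₃ dn²(x / 2g; k) / (1 + β² sn²(x / 2g; k))`. -/
def waveSq (ω c η₃ x : ℝ) : ℝ :=
  η₃ * (jacobiDn (x / (2 * paramG ω c η₃)) (modulus ω c η₃) ^ 2 /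
    (1 + betaSq ω c η₃ * jacobiSn (x / (2 * paramG ω c η₃)) (modulus ω c η₃) ^ 2))

/-- The (positive) periodic wave profile `Φ^L_{ω,c}`. -/
def periodicWave (ω c L x : ℝ) : ℝ := Real.sqrt (waveSq ω c (eta3 ω c L) x)

/-! ### Sobolev norms on a bounded interval -/

/-- `g` is the weak derivative of order `j` of `f` on the open interval `(a, b)`. -/
def IsWeakDeriv (a b : ℝ) (j : ℕ) (f g : ℝ → ℝ) : Prop :=
  LocallyIntegrableOn f (Ioo a b) ∧ LocallyIntegrableOn g (Ioo a b) ∧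
  ∀ φ : ℝ → ℝ, ContDiff ℝ (⊤ : ℕ∞) φ → HasCompactSupport φ → tsupport φ ⊆ Ioo a b →
    ∫ x in Ioo a b, f x * iteratedDeriv j φ x = (-1) ^ j * ∫ x in Ioo a b, g x * φ x

/-- The norm of `f` in `H^m((a, b))`, that is `(∑_{j ≤ m} ‖f^{(j)}‖²_{L²(a,b)})^{1/2}` with weak
derivatives `f^{(j)}`. Weak derivatives are unique almost everywhere, so the infimum is over
families with one and the same value; it is `∞` if `f` is not in `H^m((a, b))`. -/
def sobolevNorm (m : ℕ) (a b : ℝ) (f : ℝ → ℝ) : ℝ≥0∞ :=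
  ⨅ (g : ℕ → ℝ → ℝ) (_ : ∀ j ≤ m, IsWeakDeriv a b j f (g j)),
    (∑ j ∈ Finset.range (m + 1),
      eLpNorm (g j) 2 (volume.restrict (Ioo a b)) ^ 2) ^ (1 / 2 : ℝ)

end

end DNLS

open DNLS

/-! Soliton and periodic waves solve the same autonomous Newton equation `f'' = waveForce ω c f`,
start at rest at `x = 0`, and differ only in the initial height: `√α₁` against `√η₃(L)`. In terms of
`r = 1/f²` each profile satisfies a cubic first integral whose only free constant is `p = -η₁η₂η₃`
(zero for the soliton), and `p` cancels from the second-order equation for `f`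
(`IsReciprocalProfile.isNewtonSolution`).

Existence and uniqueness of `η₃(L)`. The period equals `8 ∫₀^{π/2} (P cos² + Q sin²)^{-1/2}` with `P
= η₃(η₂-η₁)`, `Q = η₂(η₃-η₁)`. This integral is strictly decreasing in `(P+Q, PQ)`
(`symmetricK_lt`), while `P+Q` and `PQ` are functions of `η₁` alone that decrease as `η₁` grows, and
`η₁` increases with `η₃`. Hence the period is strictly increasing (`strictMonoOn_period`). It is
continuous, equals `2L₀` at `α₀`, and diverges logarithmically at `α₁`, where `Q → 0`. The same
monotonicity forces `η₃(L) → α₁`.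

Convergence. Gronwall gives pointwise convergence of `(f, f')`. Every derivative of `f` is a fixed
smooth function of `(f, f')`, so it converges pointwise as well. What remains is a dominating
function independent of `L`: `waveSq_mul_sq_le` bounds `f² x²` on a half period uniformly for large
`L`, and the first integral transfers the bound to `f'`. The squared differences of derivatives are
then at most a constant times `(1 + x²)⁻¹`, and dominated convergence concludes
(`tendsto_sobolevNorm_newton_sub`). -/

section SmoothFunctions

open scoped ContDiff

/-! ### Sobolev norms of smooth functions -/

theorem integral_mul_iteratedDeriv_eq {φ : ℝ → ℝ} (hφ : ContDiff ℝ ∞ φ)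
    (hc : HasCompactSupport φ) (j : ℕ) {f : ℝ → ℝ} (hf : ContDiff ℝ ∞ f) :
    ∫ x, f x * iteratedDeriv j φ x = (-1) ^ j * ∫ x, iteratedDeriv j f x * φ x := by
  induction j generalizing f with
  | zero => simp
  | succ j ih =>
    have hfd : ContDiff ℝ ∞ (deriv f) := (contDiff_infty_iff_deriv.1 hf).2
    have hψ : ContDiff ℝ ∞ (iteratedDeriv j φ) := by
      rw [iteratedDeriv_eq_iterate]; exact hφ.iterate_deriv j
    have hψc : HasCompactSupport (iteratedDeriv j φ) := by
      clear ih
      rw [iteratedDeriv_eq_iterate]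
      induction j with
      | zero => simpa using hc
      | succ i hi =>
        rw [Function.iterate_succ_apply']
        refine (hi ?_).deriv
        rw [iteratedDeriv_eq_iterate]; exact hφ.iterate_deriv i
    have hψd : ContDiff ℝ ∞ (deriv (iteratedDeriv j φ)) := (contDiff_infty_iff_deriv.1 hψ).2
    have key := integral_mul_deriv_eq_deriv_mul_of_integrable (u := f) (u' := deriv f)
      (v := iteratedDeriv j φ) (v' := deriv (iteratedDeriv j φ))
      (fun x _ => (hf.differentiable (by simp)).differentiableAt.hasDerivAt)
      (fun x _ => (hψ.differentiable (by simp)).differentiableAt.hasDerivAt)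
      ((hf.continuous.mul hψd.continuous).integrable_of_hasCompactSupport hψc.deriv.mul_left)
      ((hfd.continuous.mul hψ.continuous).integrable_of_hasCompactSupport hψc.mul_left)
      ((hf.continuous.mul hψ.continuous).integrable_of_hasCompactSupport hψc.mul_left)
    rw [iteratedDeriv_succ, key, ih hfd, iteratedDeriv_succ', pow_succ]
    ring

/-- Test functions supported in the open interval extend by zero to the line, so integration by
parts has no boundary terms. -/
theorem isWeakDeriv_iteratedDeriv {f : ℝ → ℝ} (hf : ContDiff ℝ ∞ f) (a b : ℝ) (j : ℕ) :
    IsWeakDeriv a b j f (iteratedDeriv j f) := by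
  have hd : ContDiff ℝ ∞ (iteratedDeriv j f) := by
    rw [iteratedDeriv_eq_iterate]; exact hf.iterate_deriv j
  refine ⟨hf.continuous.locallyIntegrable.locallyIntegrableOn _,
    hd.continuous.locallyIntegrable.locallyIntegrableOn _, fun φ hφ hc hs => ?_⟩
  have hφ0 : ∀ x ∉ Ioo a b, φ x = 0 := fun x hx => image_eq_zero_of_notMem_tsupport fun h => hx (hs h)
  have hφj : ∀ x ∉ Ioo a b, iteratedDeriv j φ x = 0 := fun x hx => by
    have : x ∉ tsupport (iteratedFDeriv ℝ j φ) := fun h =>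
      hx (hs (tsupport_iteratedFDeriv_subset j h))
    rw [iteratedDeriv_eq_iteratedFDeriv, image_eq_zero_of_notMem_tsupport this]; rfl
  rw [setIntegral_eq_integral_of_forall_compl_eq_zero fun x hx => by simp [hφj x hx],
    setIntegral_eq_integral_of_forall_compl_eq_zero fun x hx => by simp [hφ0 x hx]]
  exact integral_mul_iteratedDeriv_eq hφ hc j hf

theorem sobolevNorm_le_of_contDiff {f : ℝ → ℝ} (hf : ContDiff ℝ ∞ f) (m : ℕ) (a b : ℝ) :
    sobolevNorm m a b f ≤ (∑ j ∈ Finset.range (m + 1),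
      eLpNorm (iteratedDeriv j f) 2 (volume.restrict (Ioo a b)) ^ 2) ^ (1 / 2 : ℝ) :=
  iInf₂_le (fun j => iteratedDeriv j f) fun j _ => isWeakDeriv_iteratedDeriv hf a b j

/-- The norm is an infimum over weak derivatives, so inserting the classical ones already gives the
upper bound needed here. -/
theorem tendsto_sobolevNorm_zero {f : ℝ → ℝ → ℝ} (hf : ∀ᶠ L in atTop, ContDiff ℝ ∞ (f L))
    (h : ∀ j : ℕ, Tendsto (fun L : ℝ =>
      eLpNorm (iteratedDeriv j (f L)) 2 (volume.restrict (Ioo (-L) L)) ^ 2) atTop (𝓝 0)) (m : ℕ) :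
    Tendsto (fun L : ℝ => sobolevNorm m (-L) L (f L)) atTop (𝓝 0) := by
  have h1 := tendsto_finsetSum (Finset.range (m + 1)) fun j _ => h j
  have h2 := h1.ennrpow_const (1 / 2 : ℝ)
  rw [Finset.sum_const_zero, ENNReal.zero_rpow_of_pos (by norm_num)] at h2
  refine tendsto_of_tendsto_of_tendsto_of_le_of_le' tendsto_const_nhds h2
    (Eventually.of_forall fun _ => zero_le) ?_
  filter_upwards [hf] with L hL using sobolevNorm_le_of_contDiff hL m _ _

/-! ### Newton equations `f'' = G(f)` -/

/-- `f` solves `f'' = G(f)`, and `v` is its derivative. -/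
structure IsNewtonSolution (G f v : ℝ → ℝ) : Prop where
  hasDerivAt : ∀ x, HasDerivAt f (v x) x
  hasDerivAt_velocity : ∀ x, HasDerivAt v (G (f x)) x

namespace IsNewtonSolution

/-- Differentiating `P(f, v)` along the flow `(f, v)' = (v, G(f))` gives another smooth function of
`(f, v)`. `P` depends only on `G` and `j`, so one Lipschitz constant serves all solutions. -/
theorem exists_iteratedDeriv_eq {G : ℝ → ℝ} (hG : ContDiff ℝ ∞ G) (j : ℕ) :
    ∃ P : ℝ × ℝ → ℝ, ContDiff ℝ ∞ P ∧
      ∀ f v : ℝ → ℝ, IsNewtonSolution G f v → iteratedDeriv j f = fun x => P (f x, v x) := by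
  induction j with
  | zero => exact ⟨Prod.fst, contDiff_fst, fun f v _ => by simp⟩
  | succ j ih =>
    obtain ⟨P, hP, h⟩ := ih
    refine ⟨fun z => fderiv ℝ P z (z.2, G z.1), ?_, fun f v hf => ?_⟩
    · exact (hP.fderiv_right (m := ∞) (by simp)).clm_apply
        (contDiff_snd.prodMk (hG.comp contDiff_fst))
    · rw [iteratedDeriv_succ, h f v hf]
      ext x
      have h1 := (hP.differentiable (by simp)).differentiableAt (x := (f x, v x))
      have h2 := h1.hasFDerivAt.comp_hasDerivAt x
        ((hf.hasDerivAt x).prodMk (hf.hasDerivAt_velocity x))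
      exact h2.deriv

variable {G f v g w : ℝ → ℝ}

theorem contDiff (hG : ContDiff ℝ ∞ G) (hf : IsNewtonSolution G f v) : ContDiff ℝ ∞ f := by
  refine contDiff_of_differentiable_iteratedDeriv fun j _ => ?_
  obtain ⟨P, hP, h⟩ := exists_iteratedDeriv_eq hG j
  rw [h f v hf]
  exact (hP.differentiable (by simp)).comp fun x =>
    ((hf.hasDerivAt x).prodMk (hf.hasDerivAt_velocity x)).differentiableAt

theorem comp_neg (hf : IsNewtonSolution G f v) :
    IsNewtonSolution G (fun x => f (-x)) (fun x => -v (-x)) where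
  hasDerivAt x := ((hf.hasDerivAt (-x)).scomp x (hasDerivAt_neg x)).congr_deriv (by simp)
  hasDerivAt_velocity x :=
    ((hf.hasDerivAt_velocity (-x)).scomp x (hasDerivAt_neg x)).neg.congr_deriv (by simp)

end IsNewtonSolution

theorem exists_lipschitzOnWith_closedBall {P : ℝ × ℝ → ℝ} (hP : ContDiff ℝ ∞ P) (R : ℝ) :
    ∃ K : NNReal, LipschitzOnWith K P (Metric.closedBall 0 R) :=
  (hP.of_le (by simp)).locallyLipschitz.locallyLipschitzOn.exists_lipschitzOnWith_of_compact
    (isCompact_closedBall _ _)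

theorem mem_closedBall_zero_prod {R x y : ℝ} (hx : |x| ≤ R) (hy : |y| ≤ R) :
    (x, y) ∈ Metric.closedBall (0 : ℝ × ℝ) R := by
  simp [Prod.norm_def, hx, hy]

/-- Continuous dependence on the initial data. -/
theorem exists_dist_le_newton {G : ℝ → ℝ} (hG : ContDiff ℝ ∞ G) (R : ℝ) :
    ∃ K : ℝ, ∀ f v g w : ℝ → ℝ, IsNewtonSolution G f v → IsNewtonSolution G g w →
      v 0 = 0 → w 0 = 0 → ∀ x,
      (∀ y, |y| ≤ |x| → |f y| ≤ R ∧ |v y| ≤ R ∧ |g y| ≤ R ∧ |w y| ≤ R) →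
      dist (f x, v x) (g x, w x) ≤ |f 0 - g 0| * Real.exp (K * |x|) := by
  obtain ⟨K, hK⟩ := exists_lipschitzOnWith_closedBall (hG.comp contDiff_fst) R
  have hF : LipschitzOnWith (max 1 K) (fun z : ℝ × ℝ => (z.2, G z.1)) (Metric.closedBall 0 R) :=
    LipschitzWith.prod_snd.lipschitzOnWith.prodMk hK
  refine ⟨(max 1 K : NNReal), ?_⟩
  have pos : ∀ f v g w : ℝ → ℝ, IsNewtonSolution G f v → IsNewtonSolution G g w →
      v 0 = 0 → w 0 = 0 → ∀ x, 0 ≤ x →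
      (∀ y, |y| ≤ |x| → |f y| ≤ R ∧ |v y| ≤ R ∧ |g y| ≤ R ∧ |w y| ≤ R) →
      dist (f x, v x) (g x, w x) ≤ |f 0 - g 0| * Real.exp ((max 1 K : NNReal) * |x|) := by
    intro f v g w hf hg hv hw x hx hb
    have hdf := fun t => (hf.hasDerivAt t).prodMk (hf.hasDerivAt_velocity t)
    have hdg := fun t => (hg.hasDerivAt t).prodMk (hg.hasDerivAt_velocity t)
    have hb' : ∀ t ∈ Ico 0 x, |f t| ≤ R ∧ |v t| ≤ R ∧ |g t| ≤ R ∧ |w t| ≤ R := fun t ht =>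
      hb t (by rw [abs_of_nonneg ht.1, abs_of_nonneg hx]; exact ht.2.le)
    have := dist_le_of_trajectories_ODE_of_mem (v := fun _ z => (z.2, G z.1))
      (s := fun _ => Metric.closedBall (0 : ℝ × ℝ) R) (K := max 1 K)
      (f := fun t => (f t, v t)) (g := fun t => (g t, w t)) (a := 0) (b := x) (δ := |f 0 - g 0|)
      (fun _ _ => hF) (fun t _ => (hdf t).continuousAt.continuousWithinAt)
      (fun t _ => (hdf t).hasDerivWithinAt)
      (fun t ht => mem_closedBall_zero_prod (hb' t ht).1 (hb' t ht).2.1)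
      (fun t _ => (hdg t).continuousAt.continuousWithinAt)
      (fun t _ => (hdg t).hasDerivWithinAt)
      (fun t ht => mem_closedBall_zero_prod (hb' t ht).2.2.1 (hb' t ht).2.2.2)
      (by simp [Prod.dist_eq, hv, hw, Real.dist_eq]) x ⟨hx, le_rfl⟩
    simpa [abs_of_nonneg hx] using this
  intro f v g w hf hg hv hw x hb
  rcases le_total 0 x with hx | hx
  · exact pos f v g w hf hg hv hw x hx hb
  -- The equation is reversible: negative times follow by reflecting both solutions.
  · have := pos _ _ _ _ hf.comp_neg hg.comp_neg (by simpa using hv) (by simpa using hw) (-x)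
      (by linarith) (fun y hy => by simpa using hb (-y) (by simpa using hy))
    simpa [Prod.dist_eq, Real.dist_eq, abs_sub_comm, add_comm, sub_eq_add_neg] using this

/-- Dominated convergence on the whole line, after extending the integrand by zero outside `(-L,
L)`. The decay of `f L` is required only on that interval, since a periodic wave does not decay
beyond it. -/
theorem tendsto_sobolevNorm_newton_sub {G : ℝ → ℝ} (hG : ContDiff ℝ ∞ G)
    {f v : ℝ → ℝ → ℝ} {g w : ℝ → ℝ} {C : ℝ}
    (hf : ∀ᶠ L in atTop, IsNewtonSolution G (f L) (v L)) (hg : IsNewtonSolution G g w)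
    (hv0 : ∀ᶠ L in atTop, v L 0 = 0) (hw0 : w 0 = 0)
    (h0 : Tendsto (fun L => f L 0) atTop (𝓝 (g 0)))
    (hfC : ∀ᶠ L in atTop, ∀ x, |x| < L →
      f L x ^ 2 ≤ C * (1 + x ^ 2)⁻¹ ∧ v L x ^ 2 ≤ C * (1 + x ^ 2)⁻¹)
    (hgC : ∀ x, g x ^ 2 ≤ C * (1 + x ^ 2)⁻¹ ∧ w x ^ 2 ≤ C * (1 + x ^ 2)⁻¹) (m : ℕ) :
    Tendsto (fun L : ℝ => sobolevNorm m (-L) L (fun x => f L x - g x)) atTop (𝓝 0) := by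
  have hgs := hg.contDiff hG
  have hC : 0 ≤ C := by have := (hgC 0).1; simp at this; nlinarith [sq_nonneg (g 0)]
  set R := Real.sqrt C with hR
  have hbd : ∀ x y : ℝ, y ^ 2 ≤ C * (1 + x ^ 2)⁻¹ → |y| ≤ R := fun x y h => by
    apply Real.abs_le_sqrt
    refine h.trans (mul_le_of_le_one_right hC (inv_le_one_of_one_le₀ (by nlinarith)))
  refine tendsto_sobolevNorm_zero (hf.mono fun L hL => (hL.contDiff hG).sub hgs) (fun j => ?_) m
  obtain ⟨P, hP, hPj⟩ := IsNewtonSolution.exists_iteratedDeriv_eq hG j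
  obtain ⟨M, hM⟩ := exists_lipschitzOnWith_closedBall hP R
  obtain ⟨K, hK⟩ := exists_dist_le_newton hG R
  have hderiv : ∀ᶠ L in atTop, iteratedDeriv j (fun x => f L x - g x) =
      fun x => P (f L x, v L x) - P (g x, w x) := by
    filter_upwards [hf] with L hL
    ext x
    have h1 := iteratedDeriv_sub (n := j) (x := x)
      ((hL.contDiff hG).contDiffAt.of_le (by exact_mod_cast le_top))
      (hgs.contDiffAt.of_le (by exact_mod_cast le_top))
    rw [hPj _ _ hL, hPj _ _ hg] at h1
    exact h1
  have hlip : ∀ᶠ L in atTop, ∀ x, |x| < L → |P (f L x, v L x) - P (g x, w x)| ≤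
      M * dist (f L x, v L x) (g x, w x) := by
    filter_upwards [hfC] with L hL x hx
    have := hM.dist_le_mul _ (mem_closedBall_zero_prod (hbd x _ (hL x hx).1) (hbd x _ (hL x hx).2))
      _ (mem_closedBall_zero_prod (hbd x _ (hgC x).1) (hbd x _ (hgC x).2))
    simpa [Real.dist_eq] using this
  have hsq : ∀ᶠ L in atTop, eLpNorm (iteratedDeriv j (fun x => f L x - g x)) 2
      (volume.restrict (Ioo (-L) L)) ^ 2 =
      ∫⁻ x, (Ioo (-L) L).indicator (fun x => ‖P (f L x, v L x) - P (g x, w x)‖ₑ ^ 2) x := by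
    filter_upwards [hderiv] with L hL
    rw [lintegral_indicator measurableSet_Ioo, hL]
    have := eLpNorm_nnreal_pow_eq_lintegral (μ := volume.restrict (Ioo (-L) L))
      (f := fun x => P (f L x, v L x) - P (g x, w x)) (p := 2) (by norm_num)
    simpa using this
  refine Tendsto.congr' (hsq.mono fun L hL => hL.symm) ?_
  rw [show (𝓝 (0 : ℝ≥0∞)) = 𝓝 (∫⁻ _ : ℝ, (0 : ℝ≥0∞)) by simp]
  -- `M` is the Lipschitz constant of `P`. The factor `4 C` comes from `(a - b)² ≤ 2a² + 2b²`,
  -- applied to both components of the sup distance.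
  refine tendsto_lintegral_filter_of_dominated_convergence
    (fun x => ENNReal.ofReal (M ^ 2 * (4 * C) * (1 + x ^ 2)⁻¹)) ?_ ?_ ?_ ?_
  · filter_upwards [hf] with L hL
    refine Measurable.indicator ?_ measurableSet_Ioo
    have h1 : Continuous fun x => (f L x, v L x) := continuous_iff_continuousAt.2 fun x =>
      ((hL.hasDerivAt x).prodMk (hL.hasDerivAt_velocity x)).continuousAt
    have h2 : Continuous fun x => (g x, w x) := continuous_iff_continuousAt.2 fun x =>
      ((hg.hasDerivAt x).prodMk (hg.hasDerivAt_velocity x)).continuousAt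
    have h3 := (hP.continuous.comp h1).sub (hP.continuous.comp h2)
    exact (h3.enorm.measurable).pow_const 2
  · filter_upwards [hlip, hfC] with L hL hLC
    refine Eventually.of_forall fun x => indicator_apply_le' (fun hx => ?_) fun _ => zero_le
    have hx' : |x| < L := abs_lt.2 hx
    rw [Real.enorm_eq_ofReal_abs, ← ENNReal.ofReal_pow (abs_nonneg _)]
    refine ENNReal.ofReal_le_ofReal ?_
    have h1 := pow_le_pow_left₀ (abs_nonneg _) (hL x hx') 2
    refine h1.trans ?_
    rw [mul_pow, mul_assoc]
    refine mul_le_mul_of_nonneg_left ?_ (sq_nonneg _)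
    rw [Prod.dist_eq, Real.dist_eq, Real.dist_eq]
    obtain ⟨a1, a2⟩ := hLC x hx'
    obtain ⟨b1, b2⟩ := hgC x
    rcases max_choice |f L x - g x| |v L x - w x| with h | h <;> rw [h, sq_abs]
    · nlinarith [sq_nonneg (f L x + g x)]
    · nlinarith [sq_nonneg (v L x + w x)]
  · exact ((integrable_inv_one_add_sq.const_mul _).lintegral_lt_top).ne
  · refine Eventually.of_forall fun x => ?_
    have hlim : Tendsto (fun L => M * (|f L 0 - g 0| * Real.exp (K * |x|))) atTop (𝓝 0) := by
      have := (((h0.sub_const (g 0)).abs).mul_const (Real.exp (K * |x|))).const_mul (M : ℝ)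
      simpa using this
    have hlim2 := (ENNReal.tendsto_ofReal (hlim.pow 2))
    rw [zero_pow two_ne_zero, ENNReal.ofReal_zero] at hlim2
    refine tendsto_of_tendsto_of_tendsto_of_le_of_le' tendsto_const_nhds hlim2
      (Eventually.of_forall fun _ => zero_le) ?_
    filter_upwards [hlip, hfC, hf, hv0, eventually_gt_atTop |x|] with L hL hLC hLf hL0 hxL
    refine indicator_apply_le' (fun _ => ?_) fun _ => zero_le
    rw [Real.enorm_eq_ofReal_abs, ← ENNReal.ofReal_pow (abs_nonneg _)]
    refine ENNReal.ofReal_le_ofReal (pow_le_pow_left₀ (abs_nonneg _) ((hL x hxL).trans ?_) 2)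
    refine mul_le_mul_of_nonneg_left ?_ M.2
    refine hK _ _ _ _ hLf hg hL0 hw0 x fun y hy => ?_
    obtain ⟨a1, a2⟩ := hLC y (hy.trans_lt hxL)
    exact ⟨hbd y _ a1, hbd y _ a2, hbd y _ (hgC y).1, hbd y _ (hgC y).2⟩

end SmoothFunctions

/-! ### The profile equation -/

/-- Solitons and periodic profiles solve `f'' = waveForce ω c f`. -/
noncomputable def waveForce (ω c y : ℝ) : ℝ :=
  (-3 * y ^ 5 + 8 * c * y ^ 3 + (16 * ω - 4 * c ^ 2) * y) / 16

theorem contDiff_waveForce (ω c : ℝ) : ContDiff ℝ (⊤ : ℕ∞) (waveForce ω c) := by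
  unfold waveForce; fun_prop

/-- `r` solves the Weierstrass-type equation satisfied by the reciprocal of the squared profile, with
first integral `p`. -/
structure IsReciprocalProfile (ω c p : ℝ) (r r' r'' : ℝ → ℝ) : Prop where
  pos : ∀ x, 0 < r x
  hasDerivAt : ∀ x, HasDerivAt r (r' x) x
  hasDerivAt_deriv : ∀ x, HasDerivAt r' (r'' x) x
  energy : ∀ x, 4 * r' x ^ 2 =
    -1 + 4 * c * r x + (16 * ω - 4 * c ^ 2) * r x ^ 2 - p * r x ^ 3
  force : ∀ x, 8 * r'' x = 4 * c + 2 * (16 * ω - 4 * c ^ 2) * r x - 3 * p * r x ^ 2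

namespace IsReciprocalProfile

variable {ω c p : ℝ} {r r' r'' : ℝ → ℝ}

/-- With `f = r^{-1/2}`, `f''` combines `r'²` and `r''`; inserting `energy` and `force`, the two
terms in `p` cancel. `force` is a separate hypothesis because differentiating `energy` yields it
only where `r' ≠ 0`. -/
theorem isNewtonSolution (h : IsReciprocalProfile ω c p r r' r'') :
    IsNewtonSolution (waveForce ω c) (fun x => (√(r x))⁻¹)
      (fun x => -((√(r x))⁻¹ ^ 3 * r' x) / 2) := by
  have hf : ∀ x, HasDerivAt (fun x => (√(r x))⁻¹) (-((√(r x))⁻¹ ^ 3 * r' x) / 2) x := fun x => by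
    have hs : 0 < √(r x) := Real.sqrt_pos.2 (h.pos x)
    refine (((h.hasDerivAt x).sqrt (h.pos x).ne').inv hs.ne').congr_deriv ?_
    field_simp
  refine ⟨hf, fun x => ?_⟩
  have hs : 0 < √(r x) := Real.sqrt_pos.2 (h.pos x)
  refine ((((hf x).pow 3).mul (h.hasDerivAt_deriv x)).neg.div_const 2).congr_deriv ?_
  have e1 := h.energy x
  have e2 := h.force x
  have e3 : r x = √(r x) ^ 2 := (Real.sq_sqrt (h.pos x).le).symm
  simp only [waveForce, Pi.pow_apply, Nat.add_one_sub_one]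
  generalize √(r x) = q at *
  rw [e3] at e1 e2
  field_simp
  push_cast
  linear_combination 12 * e1 - 4 * q ^ 2 * e2

/-- The first integral reads `16 v² = -f⁶ + 4c f⁴ + (16ω - 4c²) f² - p`; the terms `-f⁶` and `-p`
are dropped. -/
theorem velocity_sq_le (h : IsReciprocalProfile ω c p r r' r'') (hp : 0 ≤ p) (x : ℝ) :
    (-((√(r x))⁻¹ ^ 3 * r' x) / 2) ^ 2 ≤
      (√(r x))⁻¹ ^ 2 * (4 * c * (√(r x))⁻¹ ^ 2 + (16 * ω - 4 * c ^ 2)) / 16 := by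
  have hs : 0 < √(r x) := Real.sqrt_pos.2 (h.pos x)
  have e1 := h.energy x
  have e3 : r x = √(r x) ^ 2 := (Real.sq_sqrt (h.pos x).le).symm
  generalize √(r x) = q at *
  rw [e3] at e1
  have : (-((q)⁻¹ ^ 3 * r' x) / 2) ^ 2 = q⁻¹ ^ 6 * (4 * r' x ^ 2) / 16 := by ring
  rw [this, e1]
  have h2 : q⁻¹ ^ 2 * (4 * c * q⁻¹ ^ 2 + (16 * ω - 4 * c ^ 2)) / 16 - q⁻¹ ^ 6 *
    (-1 + 4 * c * q ^ 2 + (16 * ω - 4 * c ^ 2) * (q ^ 2) ^ 2 - p * (q ^ 2) ^ 3) / 16 =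
    (q⁻¹ ^ 6 + p) / 16 := by field_simp; ring
  have h3 : 0 ≤ (q⁻¹ ^ 6 + p) / 16 := by positivity
  linarith

end IsReciprocalProfile

/-! ### The soliton -/

theorem DNLS.Admissible.omega_pos {ω c : ℝ} (h : Admissible ω c) : 0 < ω := by
  rcases h with h | ⟨h, hc⟩ <;> nlinarith [sq_nonneg c]

theorem DNLS.Admissible.sq_le {ω c : ℝ} (h : Admissible ω c) : c ^ 2 ≤ 4 * ω := by
  rcases h with h | ⟨h, hc⟩ <;> linarith

theorem DNLS.Admissible.abs_le {ω c : ℝ} (h : Admissible ω c) : |c| ≤ 2 * √ω := by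
  have h1 := Real.sq_sqrt h.omega_pos.le
  apply abs_le_of_sq_le_sq _ (by positivity)
  nlinarith [h.sq_le]

theorem DNLS.Admissible.neg_lt {ω c : ℝ} (h : Admissible ω c) : -(2 * √ω) < c := by
  have h1 := Real.sq_sqrt h.omega_pos.le
  have h2 := Real.sqrt_pos.2 h.omega_pos
  rcases h with h | ⟨h, hc⟩
  · nlinarith
  · linarith

theorem one_add_half_sq_le_cosh (y : ℝ) : 1 + y ^ 2 / 2 ≤ Real.cosh y := by
  have h1 : Real.cosh y = 2 * Real.sinh (y / 2) ^ 2 + 1 := by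
    have := Real.cosh_two_mul (y / 2)
    rw [Real.cosh_sq, mul_div_cancel₀ y two_ne_zero] at this
    linarith
  have h2 : (y / 2) ^ 2 ≤ Real.sinh (y / 2) ^ 2 := by
    rw [sq_le_sq, Real.abs_sinh]
    exact Real.self_le_sinh_iff.2 (abs_nonneg _)
  rw [h1]; linarith

theorem exists_reciprocal_soliton {ω c : ℝ} (h : Admissible ω c) :
    ∃ r r' r'' : ℝ → ℝ, IsReciprocalProfile ω c 0 r r' r'' ∧ r' 0 = 0 ∧ r 0 = (alpha1 ω c)⁻¹ ∧
      (∃ m > 0, ∀ x, m * (1 + x ^ 2) ≤ r x) ∧ ∀ x, solitonSq ω c x = (r x)⁻¹ := by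
  by_cases hω : c ^ 2 / 4 < ω
  · have hω0 := h.omega_pos
    have hs0 : 0 < √ω := Real.sqrt_pos.2 hω0
    have hss : √ω ^ 2 = ω := Real.sq_sqrt hω0.le
    set κ := √(4 * ω - c ^ 2) with hκ
    have hκ2 : κ ^ 2 = 4 * ω - c ^ 2 := Real.sq_sqrt (by linarith)
    have hκ0 : 0 < κ := Real.sqrt_pos.2 (by linarith)
    have hcs : c < 2 * √ω := by nlinarith
    have hcs' : -(2 * √ω) < c := h.neg_lt
    have hlow : ∀ x, √ω - c / 2 + √ω * κ ^ 2 * x ^ 2 / 2 ≤ √ω * Real.cosh (κ * x) - c / 2 :=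
      fun x => by nlinarith [one_add_half_sq_le_cosh (κ * x)]
    have hpos : ∀ x, 0 < √ω * Real.cosh (κ * x) - c / 2 := fun x => by
      have : 0 ≤ √ω * κ ^ 2 * x ^ 2 / 2 := by positivity
      linarith [hlow x]
    have hlin : ∀ x, HasDerivAt (fun x => κ * x) κ x := fun x => by
      simpa using (hasDerivAt_id x).const_mul κ
    refine ⟨fun x => (√ω * Real.cosh (κ * x) - c / 2) / κ ^ 2,
      fun x => √ω * Real.sinh (κ * x) / κ, fun x => √ω * Real.cosh (κ * x),
      ⟨fun x => div_pos (hpos x) (by positivity), fun x => ?_, fun x => ?_, fun x => ?_,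
        fun x => ?_⟩, by simp, ?_,
        -- The two coefficients of the quadratic minorant obtained from `cosh y ≥ 1 + y²/2`.
        ⟨min ((√ω - c / 2) / κ ^ 2) (√ω / 2), lt_min (div_pos (by linarith) (by positivity))
          (by positivity), fun x => ?_⟩, fun x => ?_⟩
    · refine ((((hlin x).cosh.const_mul √ω).sub_const (c / 2)).div_const (κ ^ 2)).congr_deriv ?_
      field_simp
    · refine (((hlin x).sinh.const_mul √ω).div_const κ).congr_deriv ?_
      field_simp
    · have h1 := Real.cosh_sq (κ * x)
      have h2 : 16 * ω - 4 * c ^ 2 = 4 * κ ^ 2 := by rw [hκ2]; ring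
      rw [h2]
      field_simp
      linear_combination (-32 * √ω ^ 2 * κ ^ 4) * h1 - 32 * κ ^ 4 * hss + 8 * κ ^ 4 * hκ2
    · have h2 : 16 * ω - 4 * c ^ 2 = 4 * κ ^ 2 := by rw [hκ2]; ring
      rw [h2]
      field_simp
      ring
    · have h3 : 4 * √ω + 2 * c ≠ 0 := by linarith
      simp only [mul_zero, Real.cosh_zero, alpha1]
      rw [inv_eq_one_div, div_eq_div_iff (by positivity) h3]
      linear_combination 4 * hss - hκ2
    · have h1 := min_le_left ((√ω - c / 2) / κ ^ 2) (√ω / 2)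
      have h2 := min_le_right ((√ω - c / 2) / κ ^ 2) (√ω / 2)
      have h3 : (√ω - c / 2) / κ ^ 2 + √ω / 2 * x ^ 2 ≤ (√ω * Real.cosh (κ * x) - c / 2) / κ ^ 2 := by
        rw [le_div_iff₀ (by positivity)]
        have : ((√ω - c / 2) / κ ^ 2 + √ω / 2 * x ^ 2) * κ ^ 2 =
          √ω - c / 2 + √ω * κ ^ 2 * x ^ 2 / 2 := by field_simp
        rw [this]; exact hlow x
      refine le_trans ?_ h3
      nlinarith [sq_nonneg x]
    · rw [solitonSq, if_pos hω, ← hκ, ← hκ2, inv_div]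
      congr 1
      field_simp
  · obtain ⟨h1, hc⟩ := h.resolve_left hω
    have hb : 16 * ω - 4 * c ^ 2 = 0 := by rw [h1]; ring
    have hs : √ω = c / 2 := by
      rw [h1, show c ^ 2 / 4 = (c / 2) ^ 2 by ring, Real.sqrt_sq (by positivity)]
    refine ⟨fun x => ((c * x) ^ 2 + 1) / (4 * c), fun x => c * x / 2, fun x => c / 2,
      ⟨fun x => by positivity, fun x => ?_, fun x => ?_, fun x => ?_, fun x => ?_⟩,
      by simp, ?_, ⟨min (1 / (4 * c)) (c / 4), lt_min (by positivity) (by positivity),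
        fun x => ?_⟩, fun x => ?_⟩
    · have hlin : HasDerivAt (fun x => c * x) c x := by
        simpa using (hasDerivAt_id x).const_mul c
      refine (((hlin.pow 2).add_const 1).div_const (4 * c)).congr_deriv ?_
      field_simp; norm_num; ring
    · have := ((hasDerivAt_id x).const_mul c).div_const 2
      simpa using this
    · rw [hb]; field_simp; ring
    · rw [hb]; ring
    · simp only [alpha1, hs, mul_zero]; field_simp; norm_num
    · have h2 := min_le_left (1 / (4 * c)) (c / 4)
      have h3 := min_le_right (1 / (4 * c)) (c / 4)
      have h4 : ((c * x) ^ 2 + 1) / (4 * c) = 1 / (4 * c) + c / 4 * x ^ 2 := by field_simp; ring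
      simp only [h4]
      nlinarith [sq_nonneg x]
    · rw [solitonSq, if_neg hω, inv_div]

/-! ### The Jacobi amplitude -/

section Jacobi

variable {k : ℝ}

theorem one_sub_sq_mul_sin_sq_pos (hk : k ^ 2 < 1) (θ : ℝ) : 0 < 1 - k ^ 2 * Real.sin θ ^ 2 := by
  nlinarith [Real.sin_sq_le_one θ, sq_nonneg k, sq_nonneg (Real.sin θ)]

theorem continuous_ellipticF_integrand (hk : k ^ 2 < 1) :
    Continuous fun θ => 1 / √(1 - k ^ 2 * Real.sin θ ^ 2) :=
  continuous_const.div (by fun_prop) fun θ =>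
    (Real.sqrt_pos.2 (one_sub_sq_mul_sin_sq_pos hk θ)).ne'

theorem hasDerivAt_ellipticF (hk : k ^ 2 < 1) (θ : ℝ) :
    HasDerivAt (ellipticF k) (1 / √(1 - k ^ 2 * Real.sin θ ^ 2)) θ :=
  intervalIntegral.integral_hasDerivAt_right
    ((continuous_ellipticF_integrand hk).intervalIntegrable _ _)
    ((continuous_ellipticF_integrand hk).stronglyMeasurableAtFilter _ _)
    (continuous_ellipticF_integrand hk).continuousAt

theorem ellipticF_zero : ellipticF k 0 = 0 := by simp [ellipticF]

theorem ellipticF_neg (θ : ℝ) : ellipticF k (-θ) = -ellipticF k θ := by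
  unfold ellipticF
  have := intervalIntegral.integral_comp_neg (a := 0) (b := θ)
    (fun θ => 1 / √(1 - k ^ 2 * Real.sin θ ^ 2))
  simp only [Real.sin_neg, neg_sq, neg_zero] at this
  rw [this, intervalIntegral.integral_symm]

theorem strictMono_ellipticF (hk : k ^ 2 < 1) : StrictMono (ellipticF k) :=
  strictMono_of_hasDerivAt_pos (hasDerivAt_ellipticF hk) fun θ =>
    one_div_pos.2 (Real.sqrt_pos.2 (one_sub_sq_mul_sin_sq_pos hk θ))

theorem le_ellipticF (hk : k ^ 2 < 1) {θ : ℝ} (hθ : 0 ≤ θ) : θ ≤ ellipticF k θ := by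
  have h := intervalIntegral.integral_mono_on (μ := volume) (f := fun _ => (1 : ℝ)) hθ (by simp)
    ((continuous_ellipticF_integrand hk).intervalIntegrable _ _) fun x _ => by
      rw [le_div_iff₀ (Real.sqrt_pos.2 (one_sub_sq_mul_sin_sq_pos hk x)), one_mul]
      exact Real.sqrt_le_one.2 (by nlinarith [mul_nonneg (sq_nonneg k) (sq_nonneg (Real.sin x))])
  simpa [ellipticF] using h

theorem surjective_ellipticF (hk : k ^ 2 < 1) : Function.Surjective (ellipticF k) := by
  refine Continuous.surjective
    (continuous_iff_continuousAt.2 fun θ => (hasDerivAt_ellipticF hk θ).continuousAt) ?_ ?_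
  · exact tendsto_atTop_mono' _ ((eventually_ge_atTop 0).mono fun θ hθ => le_ellipticF hk hθ)
      tendsto_id
  · refine tendsto_atBot_mono' _ ((eventually_le_atBot 0).mono fun θ hθ => ?_) tendsto_id
    have := le_ellipticF hk (θ := -θ) (by linarith)
    rw [ellipticF_neg] at this
    simp only [id]; linarith

theorem ellipticF_jacobiAm (hk : k ^ 2 < 1) (x : ℝ) : ellipticF k (jacobiAm k x) = x :=
  Function.rightInverse_invFun (surjective_ellipticF hk) x

theorem jacobiAm_ellipticF (hk : k ^ 2 < 1) (θ : ℝ) : jacobiAm k (ellipticF k θ) = θ :=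
  Function.leftInverse_invFun (strictMono_ellipticF hk).injective θ

theorem strictMono_jacobiAm (hk : k ^ 2 < 1) : StrictMono (jacobiAm k) := fun x y h => by
  rwa [← (strictMono_ellipticF hk).lt_iff_lt, ellipticF_jacobiAm hk, ellipticF_jacobiAm hk]

theorem jacobiAm_zero (hk : k ^ 2 < 1) : jacobiAm k 0 = 0 := by
  simpa [ellipticF_zero] using jacobiAm_ellipticF hk 0

theorem jacobiAm_neg (hk : k ^ 2 < 1) (x : ℝ) : jacobiAm k (-x) = -jacobiAm k x :=
  (strictMono_ellipticF hk).injective (by simp [ellipticF_neg, ellipticF_jacobiAm hk])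

theorem hasDerivAt_jacobiAm (hk : k ^ 2 < 1) (x : ℝ) :
    HasDerivAt (jacobiAm k) (√(1 - k ^ 2 * Real.sin (jacobiAm k x) ^ 2)) x := by
  have hp := Real.sqrt_pos.2 (one_sub_sq_mul_sin_sq_pos hk (jacobiAm k x))
  have hc : Continuous (jacobiAm k) := (strictMono_jacobiAm hk).monotone.continuous_of_surjective
    fun θ => ⟨_, jacobiAm_ellipticF hk θ⟩
  have := HasDerivAt.of_local_left_inverse hc.continuousAt (hasDerivAt_ellipticF hk _)
    (one_div_pos.2 hp).ne' (Eventually.of_forall (ellipticF_jacobiAm hk))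
  simpa using this

theorem hasDerivAt_sin_jacobiAm (hk : k ^ 2 < 1) (x : ℝ) :
    HasDerivAt (fun x => Real.sin (jacobiAm k x))
      (Real.cos (jacobiAm k x) * √(1 - k ^ 2 * Real.sin (jacobiAm k x) ^ 2)) x :=
  (hasDerivAt_jacobiAm hk x).sin

theorem hasDerivAt_cos_jacobiAm (hk : k ^ 2 < 1) (x : ℝ) :
    HasDerivAt (fun x => Real.cos (jacobiAm k x))
      (-Real.sin (jacobiAm k x) * √(1 - k ^ 2 * Real.sin (jacobiAm k x) ^ 2)) x :=
  (hasDerivAt_jacobiAm hk x).cos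

theorem hasDerivAt_sqrt_jacobiAm (hk : k ^ 2 < 1) (x : ℝ) :
    HasDerivAt (fun x => √(1 - k ^ 2 * Real.sin (jacobiAm k x) ^ 2))
      (-(k ^ 2 * Real.sin (jacobiAm k x) * Real.cos (jacobiAm k x))) x := by
  have h0 := one_sub_sq_mul_sin_sq_pos hk (jacobiAm k x)
  have hp := Real.sqrt_pos.2 h0
  refine (((((hasDerivAt_sin_jacobiAm hk x).pow 2).const_mul (k ^ 2)).const_sub 1).sqrt
    h0.ne').congr_deriv ?_
  simp only [Pi.pow_apply]
  field_simp
  norm_num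
  ring

/-- Since the integrand increases on `[0, π / 2]`, `F(θ, k)` is at most `θ` times its last value. -/
theorem ellipticF_mul_sqrt_le (hk : k ^ 2 < 1) {θ : ℝ} (h0 : 0 ≤ θ) (h1 : θ ≤ Real.pi / 2) :
    ellipticF k θ * √(1 - k ^ 2 * Real.sin θ ^ 2) ≤ θ := by
  have hp := Real.sqrt_pos.2 (one_sub_sq_mul_sin_sq_pos hk θ)
  rw [← le_div_iff₀ hp]
  have h := intervalIntegral.integral_mono_on (μ := volume)
    (g := fun _ => 1 / √(1 - k ^ 2 * Real.sin θ ^ 2)) h0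
    ((continuous_ellipticF_integrand hk).intervalIntegrable _ _) (by simp) fun x hx => by
      refine one_div_le_one_div_of_le hp (Real.sqrt_le_sqrt ?_)
      have hs0 : 0 ≤ Real.sin x := Real.sin_nonneg_of_nonneg_of_le_pi hx.1 (by linarith [hx.2])
      have hs : Real.sin x ≤ Real.sin θ :=
        Real.sin_le_sin_of_le_of_le_pi_div_two (by linarith [hx.1]) h1 hx.2
      have := mul_le_mul_of_nonneg_left (pow_le_pow_left₀ hs0 hs 2) (sq_nonneg k)
      linarith
  simpa [ellipticF, div_eq_mul_inv] using h

end Jacobi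

/-! ### The complete elliptic integral in symmetric form -/

/-- `∫₀^{π/2} (P cos² θ + Q sin² θ)^{-1/2} dθ`. -/
noncomputable def symmetricK (P Q : ℝ) : ℝ :=
  ∫ θ in (0 : ℝ)..(Real.pi / 2), 1 / √(P * Real.cos θ ^ 2 + Q * Real.sin θ ^ 2)

theorem le_mul_cos_sq_add_mul_sin_sq {δ P Q : ℝ} (hP : δ ≤ P) (hQ : δ ≤ Q) (θ : ℝ) :
    δ ≤ P * Real.cos θ ^ 2 + Q * Real.sin θ ^ 2 := by
  have h1 := mul_le_mul_of_nonneg_right hP (sq_nonneg (Real.cos θ))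
  have h2 := mul_le_mul_of_nonneg_right hQ (sq_nonneg (Real.sin θ))
  have h3 : δ * Real.cos θ ^ 2 + δ * Real.sin θ ^ 2 = δ := by
    rw [← mul_add, Real.cos_sq_add_sin_sq, mul_one]
  linarith

theorem mul_cos_sq_add_mul_sin_sq_pos {P Q : ℝ} (hP : 0 < P) (hQ : 0 < Q) (θ : ℝ) :
    0 < P * Real.cos θ ^ 2 + Q * Real.sin θ ^ 2 :=
  (lt_min hP hQ).trans_le (le_mul_cos_sq_add_mul_sin_sq (min_le_left P Q) (min_le_right P Q) θ)

theorem image_mul_tan_Ioo {l : ℝ} (hl : 0 < l) :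
    (fun θ => l * Real.tan θ) '' Ioo 0 (Real.pi / 2) = Ioi 0 := by
  ext t
  constructor
  · rintro ⟨θ, hθ, rfl⟩
    exact mul_pos hl (Real.tan_pos_of_pos_of_lt_pi_div_two hθ.1 hθ.2)
  · intro ht
    exact ⟨Real.arctan (t / l), ⟨Real.arctan_pos.2 (div_pos ht hl), Real.arctan_lt_pi_div_two _⟩,
      by simp only [Real.tan_arctan]; field_simp⟩

theorem integral_Ioi_eq_integral_tan {l : ℝ} (hl : 0 < l) (f : ℝ → ℝ) :
    ∫ t in Ioi 0, f t =
      ∫ θ in (0 : ℝ)..(Real.pi / 2), l / Real.cos θ ^ 2 * f (l * Real.tan θ) := by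
  have hcos : ∀ θ ∈ Ioo 0 (Real.pi / 2), 0 < Real.cos θ := fun θ hθ =>
    Real.cos_pos_of_mem_Ioo ⟨by linarith [hθ.1, Real.pi_pos], hθ.2⟩
  rw [intervalIntegral.integral_of_le (by positivity), integral_Ioc_eq_integral_Ioo,
    ← image_mul_tan_Ioo hl, integral_image_eq_integral_abs_deriv_smul measurableSet_Ioo
      (f' := fun θ => l / Real.cos θ ^ 2)]
  · refine setIntegral_congr_fun measurableSet_Ioo fun θ hθ => ?_
    have := hcos θ hθ
    simp only [smul_eq_mul]
    rw [abs_of_pos (by positivity)]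
  · intro θ hθ
    exact (((Real.hasDerivAt_tan (hcos θ hθ).ne').const_mul l).congr_deriv
      (by ring)).hasDerivWithinAt
  · intro x hx y hy hxy
    exact Real.injOn_tan ⟨by linarith [hx.1, Real.pi_pos], hx.2⟩
      ⟨by linarith [hy.1, Real.pi_pos], hy.2⟩ (mul_left_cancel₀ hl.ne' hxy)

theorem sqrt_eq_of_mul_sq {x y z : ℝ} (hy : 0 ≤ y) (h : x = y ^ 2 * z) : √x = y * √z := by
  rw [h, Real.sqrt_mul (sq_nonneg y), Real.sqrt_sq hy]

/-- The substitution `t = √Q tan θ` turns the integral into `∫₀^∞ dt / √((t²+P)(t²+Q))`, which is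
symmetric in `P` and `Q`; then `t = tan θ` returns to a compact interval. -/
theorem symmetricK_eq {P Q : ℝ} (hP : 0 < P) (hQ : 0 < Q) :
    symmetricK P Q = ∫ θ in (0 : ℝ)..(Real.pi / 2),
      1 / √((1 * Real.sin θ ^ 2 + P * Real.cos θ ^ 2) * (1 * Real.sin θ ^ 2 + Q * Real.cos θ ^ 2)) := by
  have h1 := integral_Ioi_eq_integral_tan (Real.sqrt_pos.2 hQ)
    (fun t => 1 / √((t ^ 2 + P) * (t ^ 2 + Q)))
  have h2 := integral_Ioi_eq_integral_tan one_pos (fun t => 1 / √((t ^ 2 + P) * (t ^ 2 + Q)))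
  have hcong : ∀ f g : ℝ → ℝ, (∀ θ, 0 < Real.cos θ → f θ = g θ) →
      ∫ θ in (0 : ℝ)..(Real.pi / 2), f θ = ∫ θ in (0 : ℝ)..(Real.pi / 2), g θ := by
    intro f g h
    rw [intervalIntegral.integral_of_le (by positivity),
      intervalIntegral.integral_of_le (by positivity), integral_Ioc_eq_integral_Ioo,
      integral_Ioc_eq_integral_Ioo]
    exact setIntegral_congr_fun measurableSet_Ioo fun θ hθ =>
      h θ (Real.cos_pos_of_mem_Ioo ⟨by linarith [hθ.1, Real.pi_pos], hθ.2⟩)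
  have e1 : symmetricK P Q = ∫ t in Ioi 0, 1 / √((t ^ 2 + P) * (t ^ 2 + Q)) := by
    rw [h1]
    refine hcong _ _ fun θ hθ => ?_
    have hq := Real.sqrt_pos.2 hQ
    have hpos := Real.sqrt_pos.2 (mul_cos_sq_add_mul_sin_sq_pos hP hQ θ)
    have hq2 : √Q ^ 2 = Q := Real.sq_sqrt hQ.le
    rw [sqrt_eq_of_mul_sq (x := ((√Q * Real.tan θ) ^ 2 + P) * ((√Q * Real.tan θ) ^ 2 + Q))
      (y := √Q / Real.cos θ ^ 2) (z := P * Real.cos θ ^ 2 + Q * Real.sin θ ^ 2) (by positivity)]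
    · field_simp
    · have h := Real.sin_sq_add_cos_sq θ
      rw [Real.tan_eq_sin_div_cos, mul_pow, div_pow, div_pow, hq2]
      field_simp
      linear_combination (Q * Real.sin θ ^ 2 + P * Real.cos θ ^ 2) * h
  rw [e1, h2]
  refine hcong _ _ fun θ hθ => ?_
  have hpos := Real.sqrt_pos.2 (mul_pos (mul_cos_sq_add_mul_sin_sq_pos one_pos hP (Real.pi / 2 - θ))
    (mul_cos_sq_add_mul_sin_sq_pos one_pos hQ (Real.pi / 2 - θ)))
  simp only [Real.cos_pi_div_two_sub, Real.sin_pi_div_two_sub] at hpos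
  rw [sqrt_eq_of_mul_sq (x := ((1 * Real.tan θ) ^ 2 + P) * ((1 * Real.tan θ) ^ 2 + Q))
    (y := 1 / Real.cos θ ^ 2) (z := (1 * Real.sin θ ^ 2 + P * Real.cos θ ^ 2) *
      (1 * Real.sin θ ^ 2 + Q * Real.cos θ ^ 2)) (by positivity)]
  · field_simp
  · rw [Real.tan_eq_sin_div_cos]
    field_simp

/-- The complete elliptic integral is strictly decreasing in `P + Q` and `P Q`. -/
theorem symmetricK_lt {P Q P' Q' : ℝ} (hP : 0 < P) (hQ : 0 < Q) (hP' : 0 < P') (hQ' : 0 < Q')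
    (hS : P + Q < P' + Q') (hD : P * Q ≤ P' * Q') : symmetricK P' Q' < symmetricK P Q := by
  -- The radicand is now `sin⁴ + (P+Q) sin² cos² + PQ cos⁴`, monotone in `P+Q` and `PQ`; strictness
  -- is tested at `π/4`.
  rw [symmetricK_eq hP hQ, symmetricK_eq hP' hQ']
  have hpos : ∀ {P Q : ℝ}, 0 < P → 0 < Q → ∀ θ, 0 < (1 * Real.sin θ ^ 2 + P * Real.cos θ ^ 2) *
      (1 * Real.sin θ ^ 2 + Q * Real.cos θ ^ 2) := fun hP hQ θ => by
    have := mul_pos (mul_cos_sq_add_mul_sin_sq_pos one_pos hP (Real.pi / 2 - θ))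
      (mul_cos_sq_add_mul_sin_sq_pos one_pos hQ (Real.pi / 2 - θ))
    simpa only [Real.cos_pi_div_two_sub, Real.sin_pi_div_two_sub] using this
  have hcont : ∀ {P Q : ℝ}, 0 < P → 0 < Q → Continuous fun θ =>
      1 / √((1 * Real.sin θ ^ 2 + P * Real.cos θ ^ 2) *
        (1 * Real.sin θ ^ 2 + Q * Real.cos θ ^ 2)) := fun hP hQ =>
    continuous_const.div (by fun_prop) fun θ => (Real.sqrt_pos.2 (hpos hP hQ θ)).ne'
  have hexp : ∀ P Q θ : ℝ, (1 * Real.sin θ ^ 2 + P * Real.cos θ ^ 2) *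
      (1 * Real.sin θ ^ 2 + Q * Real.cos θ ^ 2) = Real.sin θ ^ 4 +
      (P + Q) * (Real.sin θ ^ 2 * Real.cos θ ^ 2) + P * Q * Real.cos θ ^ 4 := fun P Q θ => by ring
  refine intervalIntegral.integral_lt_integral_of_continuousOn_of_le_of_exists_lt (by positivity)
    (hcont hP' hQ').continuousOn (hcont hP hQ).continuousOn (fun θ _ => ?_)
    ⟨Real.pi / 4, ⟨by positivity, by linarith [Real.pi_pos]⟩, ?_⟩
  · refine one_div_le_one_div_of_le (Real.sqrt_pos.2 (hpos hP hQ θ)) (Real.sqrt_le_sqrt ?_)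
    rw [hexp, hexp]
    gcongr
  · refine one_div_lt_one_div_of_lt (Real.sqrt_pos.2 (hpos hP hQ _))
      (Real.sqrt_lt_sqrt (hpos hP hQ _).le ?_)
    have h1 : Real.sin (Real.pi / 4) ^ 2 = 1 / 2 := by
      rw [Real.sin_pi_div_four, div_pow, Real.sq_sqrt (by norm_num)]; norm_num
    have h2 : Real.cos (Real.pi / 4) ^ 2 = 1 / 2 := by
      rw [Real.cos_pi_div_four, div_pow, Real.sq_sqrt (by norm_num)]; norm_num
    rw [h1, h2]
    nlinarith

/-- Truncating the radicand below at `δ` makes the integrand continuous for all parameters; near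
`(P, Q)` the truncation is inactive. -/
theorem continuousAt_symmetricK {P Q : ℝ} (hP : 0 < P) (hQ : 0 < Q) :
    ContinuousAt (fun z : ℝ × ℝ => symmetricK z.1 z.2) (P, Q) := by
  set δ := min P Q / 2
  have hm : 0 < min P Q := lt_min hP hQ
  have hδ : 0 < δ := by positivity
  have hδP : δ < P := by have := min_le_left P Q; simp only [δ]; linarith
  have hδQ : δ < Q := by have := min_le_right P Q; simp only [δ]; linarith
  have hc : Continuous fun z : ℝ × ℝ => ∫ θ in (0 : ℝ)..(Real.pi / 2),
      1 / √(max δ (z.1 * Real.cos θ ^ 2 + z.2 * Real.sin θ ^ 2)) := by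
    refine intervalIntegral.continuous_parametric_intervalIntegral_of_continuous' ?_ _ _
    refine continuous_const.div (by fun_prop) fun z => ?_
    exact (Real.sqrt_pos.2 (hδ.trans_le (le_max_left _ _))).ne'
  refine hc.continuousAt.congr ?_
  have h1 : ∀ᶠ z : ℝ × ℝ in 𝓝 (P, Q), δ < z.1 := continuous_fst.continuousAt.eventually_const_lt hδP
  have h2 : ∀ᶠ z : ℝ × ℝ in 𝓝 (P, Q), δ < z.2 := continuous_snd.continuousAt.eventually_const_lt hδQ
  filter_upwards [h1, h2] with z hz1 hz2
  refine intervalIntegral.integral_congr fun θ _ => ?_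
  rw [max_eq_right (le_mul_cos_sq_add_mul_sin_sq hz1.le hz2.le θ)]

/-- Logarithmic lower bound as `Q` tends to `0`. -/
theorem log_le_symmetricK {P Q N : ℝ} (hP : 0 < P) (hQ : 0 < Q) (hN : 0 < N) (hPN : P ≤ N ^ 2) :
    1 / N * (Real.log (N * (Real.pi / 2)) - Real.log √Q) ≤ symmetricK P Q := by
  have hq := Real.sqrt_pos.2 hQ
  have hlin : ∀ θ ∈ Icc 0 (Real.pi / 2), 0 < N * (Real.pi / 2 - θ) + √Q := fun θ hθ => by
    have : 0 ≤ N * (Real.pi / 2 - θ) := mul_nonneg hN.le (by linarith [hθ.2])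
    linarith
  have hcont : ContinuousOn (fun θ => 1 / (N * (Real.pi / 2 - θ) + √Q)) (Icc 0 (Real.pi / 2)) :=
    continuousOn_const.div (by fun_prop) fun θ hθ => (hlin θ hθ).ne'
  have hint : IntervalIntegrable (fun θ => 1 / (N * (Real.pi / 2 - θ) + √Q)) volume 0
      (Real.pi / 2) := hcont.intervalIntegrable_of_Icc (by positivity)
  have hval : ∫ θ in (0 : ℝ)..(Real.pi / 2), 1 / (N * (Real.pi / 2 - θ) + √Q) =
      1 / N * (Real.log (N * (Real.pi / 2) + √Q) - Real.log √Q) := by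
    rw [intervalIntegral.integral_eq_sub_of_hasDerivAt
      (f := fun θ => -(1 / N) * Real.log (N * (Real.pi / 2 - θ) + √Q)) (fun θ hθ => ?_) hint]
    · simp; ring
    · rw [uIcc_of_le (by positivity)] at hθ
      have := hlin θ hθ
      refine ((((((hasDerivAt_id θ).const_sub (Real.pi / 2)).const_mul N).add_const √Q).log
        this.ne').const_mul _).congr_deriv ?_
      simp only [id]
      field_simp
  have hmono := intervalIntegral.integral_mono_on (by positivity) hint
    (g := fun θ => 1 / √(P * Real.cos θ ^ 2 + Q * Real.sin θ ^ 2))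
    ((continuous_const.div (by fun_prop) fun θ => (Real.sqrt_pos.2
      (mul_cos_sq_add_mul_sin_sq_pos hP hQ θ)).ne').intervalIntegrable _ _) fun θ hθ => by
      -- Since `cos θ ≤ π/2 - θ`, the radicand is at most `(N(π/2 - θ))² + Q`, hence at most `(N(π/2
      -- - θ) + √Q)²`.
      refine one_div_le_one_div_of_le (Real.sqrt_pos.2 (mul_cos_sq_add_mul_sin_sq_pos hP hQ θ)) ?_
      have hl := hlin θ hθ
      have hl' : 0 ≤ N * (Real.pi / 2 - θ) := mul_nonneg hN.le (by linarith [hθ.2])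
      refine Real.sqrt_le_iff.2 ⟨hl.le, ?_⟩
      have hc0 : 0 ≤ Real.cos θ := Real.cos_nonneg_of_mem_Icc
        ⟨by linarith [hθ.1, Real.pi_pos], hθ.2⟩
      have hc1 : Real.cos θ ≤ Real.pi / 2 - θ := by
        rw [← Real.sin_pi_div_two_sub]; exact Real.sin_le (by linarith [hθ.2])
      have h1 : P * Real.cos θ ^ 2 ≤ (N * (Real.pi / 2 - θ)) ^ 2 := by
        rw [mul_pow]; gcongr
      have h2 : Q * Real.sin θ ^ 2 ≤ √Q ^ 2 := by
        rw [Real.sq_sqrt hQ.le]; nlinarith [Real.sin_sq_le_one θ]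
      nlinarith
  rw [hval] at hmono
  refine le_trans ?_ hmono
  gcongr
  linarith

/-! ### The roots of the quartic -/

section Roots

variable {ω c η : ℝ}

theorem eta1_add_eta2 (ω c η : ℝ) : eta1 ω c η + eta2 ω c η = 4 * c - η := by
  unfold eta1 eta2; ring

theorem eta2_sub_eta1 (ω c η : ℝ) : eta2 ω c η - eta1 ω c η = √(discA ω c η) := by
  unfold eta1 eta2; ring

/-- With `eta1_add_eta2` these are Vieta's relations: `η₁, η₂, η` are the roots of `y³ - 4c y² -
(16ω - 4c²) y + p`, where only `p` varies with `η`. -/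
theorem eta1_mul_eta2 (h : 0 ≤ discA ω c η) :
    eta1 ω c η * eta2 ω c η = (η - 2 * c) ^ 2 - 16 * ω := by
  have h1 := Real.sq_sqrt h
  unfold eta1 eta2
  unfold discA at h1 ⊢
  linear_combination (-1 / 4) * h1

theorem sqrt_alpha0_pos (h : Admissible ω c) : 0 < √(48 * ω + 4 * c ^ 2) :=
  Real.sqrt_pos.2 (by nlinarith [h.omega_pos, sq_nonneg c])

theorem alpha0_pos (h : Admissible ω c) : 0 < alpha0 ω c := by
  have h1 := sqrt_alpha0_pos h
  have h2 : √(48 * ω + 4 * c ^ 2) ^ 2 = 48 * ω + 4 * c ^ 2 :=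
    Real.sq_sqrt (by nlinarith [h.omega_pos, sq_nonneg c])
  have : 0 < 4 * c + √(48 * ω + 4 * c ^ 2) := by
    rcases le_or_gt 0 c with hc | hc
    · linarith
    · have : c ^ 2 < 4 * ω := by
        rcases h with h | ⟨_, h⟩ <;> linarith
      nlinarith
  unfold alpha0; linarith

theorem alpha0_lt_alpha1 (h : Admissible ω c) : alpha0 ω c < alpha1 ω c := by
  have h1 := sqrt_alpha0_pos h
  have h2 : √(48 * ω + 4 * c ^ 2) ^ 2 = 48 * ω + 4 * c ^ 2 :=
    Real.sq_sqrt (by nlinarith [h.omega_pos, sq_nonneg c])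
  have h3 := Real.sq_sqrt h.omega_pos.le
  have h4 := Real.sqrt_pos.2 h.omega_pos
  have h5 := h.neg_lt
  unfold alpha0 alpha1
  have : √(48 * ω + 4 * c ^ 2) < 12 * √ω + 2 * c := by
    apply lt_of_pow_lt_pow_left₀ 2 (by linarith)
    rw [h2]; nlinarith
  linarith

/-- The second bound implies the first, because `A(η) = 4(16ω - (η - 2c)²) + (η - 4c)²`. -/
theorem discA_pos (h : Admissible ω c) (h0 : alpha0 ω c ≤ η) (h1 : η < alpha1 ω c) :
    0 < discA ω c η ∧ (η - 2 * c) ^ 2 < 16 * ω := by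
  have h3 := Real.sq_sqrt h.omega_pos.le
  have h4 := h.neg_lt
  have h5 := (abs_le.1 h.abs_le).2
  have h6 := alpha0_pos h
  unfold alpha1 at h1
  have h7 : (η - 2 * c) ^ 2 < 16 * ω := by nlinarith
  refine ⟨?_, h7⟩
  unfold discA
  nlinarith [sq_nonneg (η - 4 * c)]

/-- `(3η - 4c)² - A(η) = 4(3η² - 8cη + 4c² - 16ω)`, and `α₀` is the larger root of the right-hand
side. The bounds say `η₂ ≤ η` and `η₂ < η`. -/
theorem sqrt_discA_le (h0 : alpha0 ω c ≤ η) (hω : 0 < ω) :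
    √(discA ω c η) ≤ 3 * η - 4 * c ∧ (alpha0 ω c < η → √(discA ω c η) < 3 * η - 4 * c) := by
  have h1 := Real.sqrt_nonneg (48 * ω + 4 * c ^ 2)
  have h2 : √(48 * ω + 4 * c ^ 2) ^ 2 = 48 * ω + 4 * c ^ 2 :=
    Real.sq_sqrt (by nlinarith [sq_nonneg c])
  have h2' : 0 < √(48 * ω + 4 * c ^ 2) := Real.sqrt_pos.2 (by nlinarith [sq_nonneg c])
  unfold alpha0 at h0 ⊢
  constructor
  · refine Real.sqrt_le_iff.2 ⟨by linarith, ?_⟩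
    unfold discA; nlinarith
  · intro h
    refine (Real.sqrt_lt' (by linarith)).2 ?_
    unfold discA; nlinarith

theorem sqrt_discA_alpha0 (h : Admissible ω c) :
    √(discA ω c (alpha0 ω c)) = 3 * alpha0 ω c - 4 * c := by
  have h2 : √(48 * ω + 4 * c ^ 2) ^ 2 = 48 * ω + 4 * c ^ 2 :=
    Real.sq_sqrt (by nlinarith [h.omega_pos, sq_nonneg c])
  have h3 := sqrt_alpha0_pos h
  rw [Real.sqrt_eq_iff_mul_self_eq_of_pos]
  · unfold alpha0 discA; linear_combination (4 / 3) * h2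
  · unfold alpha0; linarith

theorem eta2_alpha1 (h : Admissible ω c) : eta2 ω c (alpha1 ω c) = 0 := by
  have h3 := Real.sq_sqrt h.omega_pos.le
  have h5 := (abs_le.1 h.abs_le).2
  have : √(discA ω c (alpha1 ω c)) = 4 * √ω - 2 * c := by
    rw [← Real.sqrt_sq (show 0 ≤ 4 * √ω - 2 * c by linarith [Real.sqrt_nonneg ω])]
    congr 1
    unfold discA alpha1; linear_combination (-64) * h3
  unfold eta2
  rw [this]; unfold alpha1; ring

theorem eta1_neg (h : Admissible ω c) (h0 : alpha0 ω c ≤ η) (h1 : η < alpha1 ω c) :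
    eta1 ω c η < 0 := by
  obtain ⟨hA, hB⟩ := discA_pos h h0 h1
  have h2 := eta1_mul_eta2 hA.le
  have h3 := eta2_sub_eta1 ω c η
  have h4 := Real.sqrt_pos.2 hA
  by_contra! h5
  nlinarith

theorem eta2_pos (h : Admissible ω c) (h0 : alpha0 ω c ≤ η) (h1 : η < alpha1 ω c) :
    0 < eta2 ω c η := by
  obtain ⟨hA, hB⟩ := discA_pos h h0 h1
  have h2 := eta1_mul_eta2 hA.le
  have := eta1_neg h h0 h1
  by_contra! h5
  nlinarith

theorem eta2_le (h : Admissible ω c) (h0 : alpha0 ω c ≤ η) : eta2 ω c η ≤ η := by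
  have := (sqrt_discA_le h0 h.omega_pos).1
  unfold eta2; linarith

theorem eta2_lt (h : Admissible ω c) (h0 : alpha0 ω c < η) : eta2 ω c η < η := by
  have := (sqrt_discA_le h0.le h.omega_pos).2 h0
  unfold eta2; linarith

theorem eta2_alpha0 (h : Admissible ω c) : eta2 ω c (alpha0 ω c) = alpha0 ω c := by
  unfold eta2; rw [sqrt_discA_alpha0 h]; ring

/-- `√A` must fall faster than `η` rises: `A(x) - A(y) = (y - x)(3(x+y) - 8c)`, while `√A(x) + √A(y)
< 3(x+y) - 8c` by `sqrt_discA_le`. -/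
theorem strictMonoOn_eta1 (h : Admissible ω c) :
    StrictMonoOn (eta1 ω c) (Ico (alpha0 ω c) (alpha1 ω c)) := by
  intro x hx y hy hxy
  obtain ⟨hA, -⟩ := discA_pos h hx.1 hx.2
  obtain ⟨hA', -⟩ := discA_pos h hy.1 hy.2
  have a1 := (sqrt_discA_le hx.1 h.omega_pos).1
  have a2 := (sqrt_discA_le hy.1 h.omega_pos).2 (hx.1.trans_lt hxy)
  have b1 := Real.sq_sqrt hA.le
  have b2 := Real.sq_sqrt hA'.le
  have c1 := Real.sqrt_pos.2 hA
  have c2 := Real.sqrt_pos.2 hA'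
  have key : (√(discA ω c x) - √(discA ω c y)) * (√(discA ω c x) + √(discA ω c y)) =
      (y - x) * (3 * (x + y) - 8 * c) := by
    have : (√(discA ω c x) - √(discA ω c y)) * (√(discA ω c x) + √(discA ω c y)) =
      discA ω c x - discA ω c y := by linear_combination b1 - b2
    rw [this]; unfold discA; ring
  unfold eta1
  have : y - x < √(discA ω c x) - √(discA ω c y) := by
    by_contra! hle
    have h3 : (y - x) * (√(discA ω c x) + √(discA ω c y)) < (y - x) * (3 * (x + y) - 8 * c) :=
      mul_lt_mul_of_pos_left (by linarith) (by linarith)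
    have h4 := mul_le_mul_of_nonneg_right hle (by positivity : 0 ≤ √(discA ω c x) + √(discA ω c y))
    linarith
  linarith

theorem continuous_eta1 (ω c : ℝ) : Continuous (eta1 ω c) := by
  unfold eta1 discA; fun_prop

theorem continuous_eta2 (ω c : ℝ) : Continuous (eta2 ω c) := by
  unfold eta2 discA; fun_prop

end Roots

/-! ### The period -/

section Period

variable {ω c η : ℝ}

/-- In the form `P k² = P - Q` this gives `P(1 - k² sin²) = P cos² + Q sin²`. -/
theorem modulusSq_eq (h : Admissible ω c) (h0 : alpha0 ω c ≤ η) (h1 : η < alpha1 ω c) :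
    η * (eta2 ω c η - eta1 ω c η) * modulusSq ω c η =
      η * (eta2 ω c η - eta1 ω c η) - eta2 ω c η * (η - eta1 ω c η) := by
  have a := eta1_neg h h0 h1
  have b := eta2_pos h h0 h1
  have d : 0 < η := (alpha0_pos h).trans_le h0
  have e : eta2 ω c η - eta1 ω c η ≠ 0 := by linarith
  unfold modulusSq
  field_simp
  ring

theorem modulusSq_nonneg (h : Admissible ω c) (h0 : alpha0 ω c ≤ η) (h1 : η < alpha1 ω c) :
    0 ≤ modulusSq ω c η := by
  have a := eta1_neg h h0 h1
  have b := eta2_pos h h0 h1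
  have d : 0 < η := (alpha0_pos h).trans_le h0
  have e := eta2_le h h0
  exact div_nonneg (mul_nonneg (by linarith) (by linarith)) (mul_nonneg d.le (by linarith))

theorem modulus_sq (h : Admissible ω c) (h0 : alpha0 ω c ≤ η) (h1 : η < alpha1 ω c) :
    modulus ω c η ^ 2 = modulusSq ω c η :=
  Real.sq_sqrt (modulusSq_nonneg h h0 h1)

theorem modulus_sq_lt_one (h : Admissible ω c) (h0 : alpha0 ω c ≤ η) (h1 : η < alpha1 ω c) :
    modulus ω c η ^ 2 < 1 := by
  rw [modulus_sq h h0 h1]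
  have a := eta1_neg h h0 h1
  have b := eta2_pos h h0 h1
  have d : 0 < η := (alpha0_pos h).trans_le h0
  have e := modulusSq_eq h h0 h1
  have f : 0 < η * (eta2 ω c η - eta1 ω c η) := mul_pos d (by linarith)
  have g : 0 < eta2 ω c η * (η - eta1 ω c η) := mul_pos b (by linarith)
  by_contra! hle
  nlinarith

theorem period_eq_symmetricK (h : Admissible ω c) (h0 : alpha0 ω c ≤ η) (h1 : η < alpha1 ω c) :
    period ω c η = 8 * symmetricK (η * (eta2 ω c η - eta1 ω c η))
      (eta2 ω c η * (η - eta1 ω c η)) := by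
  have a := eta1_neg h h0 h1
  have b := eta2_pos h h0 h1
  have d : 0 < η := (alpha0_pos h).trans_le h0
  have e := modulusSq_eq h h0 h1
  have f : 0 < η * (eta2 ω c η - eta1 ω c η) := mul_pos d (by linarith)
  unfold period paramG ellipticK ellipticF symmetricK
  rw [show ∀ x y : ℝ, 4 * (2 / x) * y = 8 * (1 / x * y) from fun x y => by ring,
    ← intervalIntegral.integral_const_mul]
  congr 1
  refine intervalIntegral.integral_congr fun θ _ => ?_
  rw [one_div_mul_one_div, ← Real.sqrt_mul f.le, modulus_sq h h0 h1]
  congr 2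
  linear_combination (-(η * (eta2 ω c η - eta1 ω c η))) * (Real.sin_sq_add_cos_sq θ) - Real.sin θ ^ 2 * e

theorem strictMonoOn_period (h : Admissible ω c) :
    StrictMonoOn (period ω c) (Ico (alpha0 ω c) (alpha1 ω c)) := by
  intro x hx y hy hxy
  rw [period_eq_symmetricK h hx.1 hx.2, period_eq_symmetricK h hy.1 hy.2]
  have hn := strictMonoOn_eta1 h hx hy hxy
  have ax := eta1_neg h hx.1 hx.2
  have ay := eta1_neg h hy.1 hy.2
  have bx := eta2_pos h hx.1 hx.2
  have hby := eta2_pos h hy.1 hy.2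
  have dx : 0 < x := (alpha0_pos h).trans_le hx.1
  have dy : 0 < y := (alpha0_pos h).trans_le hy.1
  have sx := eta1_add_eta2 ω c x
  have sy := eta1_add_eta2 ω c y
  have px := eta1_mul_eta2 (discA_pos h hx.1 hx.2).1.le
  have py := eta1_mul_eta2 (discA_pos h hy.1 hy.2).1.le
  generalize eta1 ω c x = n at *
  generalize eta1 ω c y = m at *
  generalize eta2 ω c x = u at *
  generalize eta2 ω c y = v at *
  have hn2 : 0 < 2 * c - n := by rcases le_or_gt 0 c with hc | hc <;> linarith
  have hm2 : 0 < 2 * c - m := by rcases le_or_gt 0 c with hc | hc <;> linarith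
  -- The three roots play symmetric roles in Vieta's relations, so the product of the other two is
  -- expressed through `η₁`; this is what makes `P+Q` and `PQ` functions of `η₁` alone.
  have qx : x * u = (2 * c - n) ^ 2 - 16 * ω := by
    obtain rfl : u = 4 * c - x - n := by linarith
    linear_combination px
  have qy : y * v = (2 * c - m) ^ 2 - 16 * ω := by
    obtain rfl : v = 4 * c - y - m := by linarith
    linear_combination py
  refine mul_lt_mul_of_pos_left (symmetricK_lt (mul_pos dy (by linarith))
    (mul_pos hby (by linarith)) (mul_pos dx (by linarith)) (mul_pos bx (by linarith)) ?_ ?_)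
    (by norm_num)
  · have e1 : x * (u - n) + u * (x - n) = 3 * n ^ 2 - 12 * c * n + 8 * c ^ 2 - 32 * ω := by
      linear_combination 2 * qx - n * sx
    have e2 : y * (v - m) + v * (y - m) = 3 * m ^ 2 - 12 * c * m + 8 * c ^ 2 - 32 * ω := by
      linear_combination 2 * qy - m * sy
    rw [e1, e2]
    nlinarith
  · have e1 : x * (u - n) * (u * (x - n)) =
        (x * u) * (3 * n ^ 2 - 8 * c * n + 4 * c ^ 2 - 16 * ω) := by
      linear_combination (x * u) * (qx - n * sx)
    have e2 : y * (v - m) * (v * (y - m)) =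
        (y * v) * (3 * m ^ 2 - 8 * c * m + 4 * c ^ 2 - 16 * ω) := by
      linear_combination (y * v) * (qy - m * sy)
    rw [e1, e2]
    have e3 : (u - n) * (x - n) = 3 * n ^ 2 - 8 * c * n + 4 * c ^ 2 - 16 * ω := by
      linear_combination (qx - n * sx)
    have e4 : (v - m) * (y - m) = 3 * m ^ 2 - 8 * c * m + 4 * c ^ 2 - 16 * ω := by
      linear_combination (qy - m * sy)
    have hq : y * v ≤ x * u := by rw [qx, qy]; nlinarith
    have hr : 3 * m ^ 2 - 8 * c * m + 4 * c ^ 2 - 16 * ω ≤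
        3 * n ^ 2 - 8 * c * n + 4 * c ^ 2 - 16 * ω := by
      have : 0 < 8 * c - 3 * (n + m) := by rcases le_or_gt 0 c with hc | hc <;> linarith
      nlinarith
    refine mul_le_mul hq hr ?_ (mul_pos dx bx).le
    rw [← e4]; exact mul_nonneg (by linarith) (by linarith)

theorem continuousOn_period (h : Admissible ω c) :
    ContinuousOn (period ω c) (Ico (alpha0 ω c) (alpha1 ω c)) := by
  have c1 := continuous_eta1 ω c
  have c2 := continuous_eta2 ω c
  have : ContinuousOn (fun η => 8 * symmetricK (η * (eta2 ω c η - eta1 ω c η))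
      (eta2 ω c η * (η - eta1 ω c η))) (Ico (alpha0 ω c) (alpha1 ω c)) := by
    refine continuousOn_const.mul fun η hη => ContinuousAt.continuousWithinAt ?_
    have a := eta1_neg h hη.1 hη.2
    have b := eta2_pos h hη.1 hη.2
    have d : 0 < η := (alpha0_pos h).trans_le hη.1
    have hz : Continuous fun η => (η * (eta2 ω c η - eta1 ω c η),
      eta2 ω c η * (η - eta1 ω c η)) := by fun_prop
    exact ContinuousAt.comp (f := fun η => (η * (eta2 ω c η - eta1 ω c η),
      eta2 ω c η * (η - eta1 ω c η))) (g := fun z : ℝ × ℝ => symmetricK z.1 z.2)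
      (continuousAt_symmetricK (mul_pos d (by linarith)) (mul_pos b (by linarith)))
      hz.continuousAt
  exact this.congr fun η hη => period_eq_symmetricK h hη.1 hη.2

theorem period_alpha0 (h : Admissible ω c) :
    period ω c (alpha0 ω c) = 2 * thresholdL ω c := by
  have : modulus ω c (alpha0 ω c) = 0 := by
    unfold modulus modulusSq; rw [eta2_alpha0 h]; simp
  unfold period paramG thresholdL
  rw [this, eta2_sub_eta1]
  simp only [ellipticK, ellipticF]
  simp
  ring

theorem tendsto_period_atTop (h : Admissible ω c) :
    Tendsto (period ω c) (𝓝[<] (alpha1 ω c)) atTop := by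
  have c1 := continuous_eta1 ω c
  have c2 := continuous_eta2 ω c
  have hI : ∀ᶠ η in 𝓝[<] (alpha1 ω c), η ∈ Ico (alpha0 ω c) (alpha1 ω c) := by
    filter_upwards [Ioo_mem_nhdsLT (alpha0_lt_alpha1 h)] with η hη using ⟨hη.1.le, hη.2⟩
  set B := alpha1 ω c * (eta2 ω c (alpha1 ω c) - eta1 ω c (alpha1 ω c)) with hB
  -- `B` is the value of `P` at `α₁`, so `P < N²` near `α₁` by continuity.
  set N := √(|B| + 1) with hN
  have hN0 : 0 < N := Real.sqrt_pos.2 (by positivity)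
  have hN2 : N ^ 2 = |B| + 1 := Real.sq_sqrt (by positivity)
  have hPc : Continuous fun η => η * (eta2 ω c η - eta1 ω c η) := by fun_prop
  have hQc : Continuous fun η => eta2 ω c η * (η - eta1 ω c η) := by fun_prop
  have hP : ∀ᶠ η in 𝓝[<] (alpha1 ω c), η * (eta2 ω c η - eta1 ω c η) < N ^ 2 :=
    nhdsWithin_le_nhds (hPc.continuousAt.eventually_lt_const
      (by rw [hN2]; linarith [le_abs_self B]))
  have hQ : Tendsto (fun η => √(eta2 ω c η * (η - eta1 ω c η))) (𝓝[<] (alpha1 ω c)) (𝓝[>] 0) := by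
    refine tendsto_nhdsWithin_iff.2 ⟨?_, ?_⟩
    · have := (hQc.sqrt.tendsto (alpha1 ω c))
      rw [eta2_alpha1 h, zero_mul, Real.sqrt_zero] at this
      exact this.mono_left nhdsWithin_le_nhds
    · filter_upwards [hI] with η hη
      have a := eta1_neg h hη.1 hη.2
      have b := eta2_pos h hη.1 hη.2
      have d : 0 < η := (alpha0_pos h).trans_le hη.1
      exact Real.sqrt_pos.2 (mul_pos b (by linarith))
  have hlog := Real.tendsto_log_nhdsGT_zero.comp hQ
  have hlim := tendsto_atTop_add_const_left _ (Real.log (N * (Real.pi / 2)))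
    (tendsto_neg_atBot_atTop.comp hlog)
  have hlim2 := (hlim.const_mul_atTop (show 0 < 8 * (1 / N) by positivity))
  refine tendsto_atTop_mono' _ ?_ hlim2
  filter_upwards [hI, hP] with η hη hPη
  have a := eta1_neg h hη.1 hη.2
  have b := eta2_pos h hη.1 hη.2
  have d : 0 < η := (alpha0_pos h).trans_le hη.1
  rw [period_eq_symmetricK h hη.1 hη.2]
  have := log_le_symmetricK (mul_pos d (by linarith : 0 < eta2 ω c η - eta1 ω c η))
    (mul_pos b (by linarith : 0 < η - eta1 ω c η)) hN0 hPη.le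
  simp only [Function.comp, ← sub_eq_add_neg]
  linarith

theorem existsUnique_isMaxValue (h : Admissible ω c) {L : ℝ} (hL : thresholdL ω c < L) :
    ∃! η, IsMaxValue ω c L η := by
  have h01 := alpha0_lt_alpha1 h
  obtain ⟨y, hy1, hy2⟩ := (((tendsto_period_atTop h).eventually_gt_atTop (2 * L)).and
    (Ioo_mem_nhdsLT h01)).exists
  obtain ⟨η, hη, hp⟩ := intermediate_value_Ioo hy2.1.le ((continuousOn_period h).mono
    fun x hx => ⟨hx.1, hx.2.trans_lt hy2.2⟩)
    (show 2 * L ∈ Ioo _ _ from ⟨by rw [period_alpha0 h]; linarith, hy1⟩)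
  refine ⟨η, ⟨hη.1, hη.2.trans hy2.2, hp⟩, fun z hz => ?_⟩
  exact (strictMonoOn_period h).injOn ⟨hz.1.le, hz.2.1⟩ ⟨hη.1.le, hη.2.trans hy2.2⟩
    (hz.2.2.trans hp.symm)

theorem isMaxValue_eta3 (h : Admissible ω c) {L : ℝ} (hL : thresholdL ω c < L) :
    IsMaxValue ω c L (eta3 ω c L) :=
  Classical.epsilon_spec (existsUnique_isMaxValue h hL).exists

/-- By monotonicity of the period, `η₃(L)` exceeds `y` as soon as `2L` exceeds the period at `y`. -/
theorem tendsto_eta3 (h : Admissible ω c) :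
    Tendsto (eta3 ω c) atTop (𝓝 (alpha1 ω c)) := by
  rw [tendsto_order]
  constructor
  · intro a ha
    set y := max a (alpha0 ω c) with hy
    have hyI : y ∈ Ico (alpha0 ω c) (alpha1 ω c) :=
      ⟨le_max_right _ _, max_lt ha (alpha0_lt_alpha1 h)⟩
    filter_upwards [eventually_gt_atTop (thresholdL ω c), eventually_gt_atTop (period ω c y / 2)]
      with L h1 h2
    obtain ⟨b1, b2, b3⟩ := isMaxValue_eta3 h h1
    refine (le_max_left a _).trans_lt (((strictMonoOn_period h).lt_iff_lt hyI ⟨b1.le, b2⟩).1 ?_)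
    linarith
  · intro a ha
    filter_upwards [eventually_gt_atTop (thresholdL ω c)] with L h1
    exact (isMaxValue_eta3 h h1).2.1.trans ha

end Period

/-! ### The periodic waves -/

section PeriodicWave

variable {ω c η : ℝ}

theorem paramG_pos (h : Admissible ω c) (h0 : alpha0 ω c ≤ η) (h1 : η < alpha1 ω c) :
    0 < paramG ω c η := by
  have a := eta1_neg h h0 h1
  have b := eta2_pos h h0 h1
  have d : 0 < η := (alpha0_pos h).trans_le h0
  exact div_pos two_pos (Real.sqrt_pos.2 (mul_pos d (by linarith)))

theorem paramG_sq (h : Admissible ω c) (h0 : alpha0 ω c ≤ η) (h1 : η < alpha1 ω c) :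
    paramG ω c η ^ 2 * (η * (eta2 ω c η - eta1 ω c η)) = 4 := by
  have a := eta1_neg h h0 h1
  have b := eta2_pos h h0 h1
  have d : 0 < η := (alpha0_pos h).trans_le h0
  have e : 0 < η * (eta2 ω c η - eta1 ω c η) := mul_pos d (by linarith)
  unfold paramG
  rw [div_pow, Real.sq_sqrt e.le, div_mul_cancel₀ _ e.ne']
  norm_num

theorem betaSq_eq (h : Admissible ω c) (h0 : alpha0 ω c ≤ η) (h1 : η < alpha1 ω c) :
    betaSq ω c η = (η - eta2 ω c η) / (eta2 ω c η - eta1 ω c η) := by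
  have a := eta1_neg h h0 h1
  have b := eta2_pos h h0 h1
  have d : 0 < η := (alpha0_pos h).trans_le h0
  have e : eta2 ω c η - eta1 ω c η ≠ 0 := by linarith
  have a' := a.ne
  unfold betaSq modulusSq
  field_simp

theorem betaSq_nonneg (h : Admissible ω c) (h0 : alpha0 ω c ≤ η) (h1 : η < alpha1 ω c) :
    0 ≤ betaSq ω c η := by
  rw [betaSq_eq h h0 h1]
  exact div_nonneg (by linarith [eta2_le h h0])
    (by linarith [eta1_neg h h0 h1, eta2_pos h h0 h1])

theorem waveSq_eq (h : Admissible ω c) (h0 : alpha0 ω c ≤ η) (h1 : η < alpha1 ω c) (x : ℝ) :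
    waveSq ω c η x =
      η * (1 - modulus ω c η ^ 2 * jacobiSn (x / (2 * paramG ω c η)) (modulus ω c η) ^ 2) /
        (1 + betaSq ω c η * jacobiSn (x / (2 * paramG ω c η)) (modulus ω c η) ^ 2) := by
  unfold waveSq jacobiDn jacobiSn
  rw [Real.sq_sqrt (one_sub_sq_mul_sin_sq_pos (modulus_sq_lt_one h h0 h1) _).le, mul_div_assoc]

theorem waveSq_neg (h : Admissible ω c) (h0 : alpha0 ω c ≤ η) (h1 : η < alpha1 ω c) (x : ℝ) :
    waveSq ω c η (-x) = waveSq ω c η x := by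
  have : jacobiSn (-x / (2 * paramG ω c η)) (modulus ω c η) =
      -jacobiSn (x / (2 * paramG ω c η)) (modulus ω c η) := by
    unfold jacobiSn
    rw [neg_div, jacobiAm_neg (modulus_sq_lt_one h h0 h1), Real.sin_neg]
  rw [waveSq_eq h h0 h1, waveSq_eq h h0 h1, this, neg_sq]

theorem waveSq_zero (h : Admissible ω c) (h0 : alpha0 ω c ≤ η) (h1 : η < alpha1 ω c) :
    waveSq ω c η 0 = η := by
  rw [waveSq_eq h h0 h1]
  simp [jacobiSn, jacobiAm_zero (modulus_sq_lt_one h h0 h1)]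

theorem waveSq_le (h : Admissible ω c) (h0 : alpha0 ω c ≤ η) (h1 : η < alpha1 ω c) (x : ℝ) :
    waveSq ω c η x ≤ η := by
  rw [waveSq_eq h h0 h1]
  have d : 0 < η := (alpha0_pos h).trans_le h0
  have hβ := betaSq_nonneg h h0 h1
  have h2 := mul_nonneg hβ
    (sq_nonneg (jacobiSn (x / (2 * paramG ω c η)) (modulus ω c η)))
  have h3 := mul_nonneg (sq_nonneg (modulus ω c η))
    (sq_nonneg (jacobiSn (x / (2 * paramG ω c η)) (modulus ω c η)))
  rw [div_le_iff₀ (by linarith)]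
  exact mul_le_mul_of_nonneg_left (by linarith) d.le

/-- Decay of the squared profile on a half period, with a constant independent of the period. -/
theorem waveSq_mul_sq_le (h : Admissible ω c) (h0 : alpha0 ω c < η) (h1 : η < alpha1 ω c) {x : ℝ}
    (hx : |x| ≤ period ω c η / 2) :
    waveSq ω c η x * x ^ 2 ≤ 4 * Real.pi ^ 2 / (η - eta2 ω c η) := by
  wlog hx0 : 0 ≤ x generalizing x
  · have := this (x := -x) (by simpa using hx) (by linarith)
    rwa [waveSq_neg h h0.le h1, neg_sq] at this
  rw [abs_of_nonneg hx0] at hx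
  have a := eta1_neg h h0.le h1
  have b := eta2_pos h h0.le h1
  have d : 0 < η := (alpha0_pos h).trans h0
  have e := eta2_lt h h0
  have hk := modulus_sq_lt_one h h0.le h1
  have hg := paramG_pos h h0.le h1
  have hg2 := paramG_sq h h0.le h1
  have hβ : 0 < betaSq ω c η := by
    rw [betaSq_eq h h0.le h1]; exact div_pos (by linarith) (by linarith)
  rw [waveSq_eq h h0.le h1]
  unfold jacobiSn
  set g := paramG ω c η
  set k := modulus ω c η
  set θ := jacobiAm k (x / (2 * g)) with hθ
  have hF : ellipticF k θ = x / (2 * g) := ellipticF_jacobiAm hk _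
  have hxg : x = 2 * g * ellipticF k θ := by rw [hF]; field_simp
  have hF0 : 0 ≤ ellipticF k θ := by rw [hF]; positivity
  have hθ0 : 0 ≤ θ := by
    rw [← (strictMono_ellipticF hk).le_iff_le, ellipticF_zero]; exact hF0
  have hθ1 : θ ≤ Real.pi / 2 := by
    rw [← (strictMono_ellipticF hk).le_iff_le, hF, div_le_iff₀ (by positivity)]
    have : period ω c η = 4 * g * ellipticF k (Real.pi / 2) := rfl
    linarith
  have hX := one_sub_sq_mul_sin_sq_pos hk θ
  have hFX := ellipticF_mul_sqrt_le hk hθ0 hθ1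
  -- Jordan's inequality gives `F(θ) dn ≤ θ ≤ (π/2) sin θ`. Thus the numerator times `x²` is `O(sin²
  -- θ)`, and the denominator is at least `β² sin² θ`.
  have hsin : 2 / Real.pi * θ ≤ Real.sin θ := Real.mul_le_sin hθ0 hθ1
  have hθs : θ ≤ Real.pi / 2 * Real.sin θ := by
    have := mul_le_mul_of_nonneg_left hsin (by positivity : 0 ≤ Real.pi / 2)
    refine le_trans (le_of_eq ?_) this
    field_simp
  have hFs : ellipticF k θ ^ 2 * (1 - k ^ 2 * Real.sin θ ^ 2) ≤
      Real.pi ^ 2 / 4 * Real.sin θ ^ 2 := by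
    have := pow_le_pow_left₀ (by positivity) (hFX.trans hθs) 2
    rw [mul_pow, Real.sq_sqrt hX.le] at this
    linarith
  have hconst : 4 * Real.pi ^ 2 / (η - eta2 ω c η) = η * g ^ 2 * Real.pi ^ 2 / betaSq ω c η := by
    rw [betaSq_eq h h0.le h1]
    have h3 : η - eta2 ω c η ≠ 0 := by linarith
    have h4 : eta2 ω c η - eta1 ω c η ≠ 0 := by linarith
    field_simp
    linarith
  rw [hconst, div_mul_eq_mul_div, div_le_div_iff₀ (by positivity) hβ]
  have h5 : η * (1 - k ^ 2 * Real.sin θ ^ 2) * x ^ 2 ≤ η * g ^ 2 * Real.pi ^ 2 * Real.sin θ ^ 2 := by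
    have := mul_le_mul_of_nonneg_left hFs (by positivity : 0 ≤ 4 * η * g ^ 2)
    rw [hxg]; linarith
  have h6 := mul_le_mul_of_nonneg_right h5 hβ.le
  have h7 : 0 ≤ η * g ^ 2 * Real.pi ^ 2 := by positivity
  linarith

theorem exists_reciprocal_wave (h : Admissible ω c) (h0 : alpha0 ω c ≤ η) (h1 : η < alpha1 ω c) :
    ∃ (p : ℝ) (r r' r'' : ℝ → ℝ), 0 ≤ p ∧ IsReciprocalProfile ω c p r r' r'' ∧ r' 0 = 0 ∧
      ∀ x, waveSq ω c η x = (r x)⁻¹ := by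
  have a := eta1_neg h h0 h1
  have b := eta2_pos h h0 h1
  have d : 0 < η := (alpha0_pos h).trans_le h0
  have hk := modulus_sq_lt_one h h0 h1
  have hg := paramG_pos h h0 h1
  have hg2 := paramG_sq h h0 h1
  have hβ0 := betaSq_nonneg h h0 h1
  have hβ := betaSq_eq h h0 h1
  have hsum := eta1_add_eta2 ω c η
  have hprod := eta1_mul_eta2 (discA_pos h h0 h1).1.le
  have hk2 : modulus ω c η ^ 2 =
      -eta1 ω c η * (η - eta2 ω c η) / (η * (eta2 ω c η - eta1 ω c η)) := modulus_sq h h0 h1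
  have hw := waveSq_eq h h0 h1
  simp only [jacobiSn] at hw
  generalize paramG ω c η = g at *
  generalize modulus ω c η = k at *
  generalize betaSq ω c η = β at *
  generalize eta1 ω c η = n at *
  generalize eta2 ω c η = u at *
  have hun : 0 < u - n := by linarith
  have hb : 16 * ω - 4 * c ^ 2 = -(η * u + n * (η + u)) := by
    linear_combination hprod + η * hsum
  have hc4 : 4 * c = η + u + n := by linarith
  have hb2 : g ^ 2 = 4 / (η * (u - n)) := by rw [eq_div_iff (by positivity)]; exact hg2
  set θ : ℝ → ℝ := fun x => jacobiAm k (x / (2 * g)) with hθ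
  set D : ℝ → ℝ := fun x => √(1 - k ^ 2 * Real.sin (θ x) ^ 2) with hD
  have hXpos : ∀ x, 0 < 1 - k ^ 2 * Real.sin (θ x) ^ 2 := fun x => one_sub_sq_mul_sin_sq_pos hk _
  have hDpos : ∀ x, 0 < D x := fun x => Real.sqrt_pos.2 (hXpos x)
  have hD2 : ∀ x, D x ^ 2 = 1 - k ^ 2 * Real.sin (θ x) ^ 2 := fun x => Real.sq_sqrt (hXpos x).le
  have hcs : ∀ x, Real.cos (θ x) ^ 2 = 1 - Real.sin (θ x) ^ 2 := fun x => Real.cos_sq' _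
  have hlin : ∀ x, HasDerivAt (fun x => x / (2 * g)) (1 / (2 * g)) x := fun x =>
    (hasDerivAt_id x).div_const _
  have hs : ∀ x, HasDerivAt (fun x => Real.sin (θ x)) (Real.cos (θ x) * D x * (1 / (2 * g))) x :=
    fun x => HasDerivAt.comp (h₂ := fun y => Real.sin (jacobiAm k y)) x
      (hasDerivAt_sin_jacobiAm hk (x / (2 * g))) (hlin x)
  have hc : ∀ x, HasDerivAt (fun x => Real.cos (θ x)) (-Real.sin (θ x) * D x * (1 / (2 * g))) x :=
    fun x => HasDerivAt.comp (h₂ := fun y => Real.cos (jacobiAm k y)) x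
      (hasDerivAt_cos_jacobiAm hk (x / (2 * g))) (hlin x)
  have hDd : ∀ x, HasDerivAt D
      (-(k ^ 2 * Real.sin (θ x) * Real.cos (θ x)) * (1 / (2 * g))) x :=
    fun x => HasDerivAt.comp (h₂ := fun y => √(1 - k ^ 2 * Real.sin (jacobiAm k y) ^ 2)) x
      (hasDerivAt_sqrt_jacobiAm hk (x / (2 * g))) (hlin x)
  -- Here `p = -η₁η₂η₃`, and `r` is the reciprocal of the given formula with `D = dn`; the symbol
  -- `β` stands for `β²`.
  refine ⟨-n * u * η, fun x => (1 + β * Real.sin (θ x) ^ 2) / (η * D x ^ 2),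
    fun x => (β + k ^ 2) * (Real.sin (θ x) * Real.cos (θ x)) / (g * η * D x ^ 3),
    fun x => (β + k ^ 2) / (2 * g ^ 2 * η) * ((Real.cos (θ x) ^ 2 - Real.sin (θ x) ^ 2) / D x ^ 2 +
      3 * k ^ 2 * Real.sin (θ x) ^ 2 * Real.cos (θ x) ^ 2 / D x ^ 4),
    by have := mul_pos (mul_pos (neg_pos.2 a) b) d; linarith,
    ⟨fun x => ?_, fun x => ?_, fun x => ?_, fun x => ?_, fun x => ?_⟩, ?_, fun x => ?_⟩
  · have := hDpos x
    positivity
  · have hx := hDpos x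
    refine (((((hs x).pow 2).const_mul β).const_add 1).div (((hDd x).pow 2).const_mul η)
      (show η * D x ^ 2 ≠ 0 by positivity)).congr_deriv ?_
    simp only [Pi.pow_apply]
    field_simp
    norm_num
    linear_combination (2 * Real.cos (θ x) * Real.sin (θ x) * D x * β) * hD2 x
  · have hx := hDpos x
    refine ((((hs x).mul (hc x)).const_mul (β + k ^ 2)).div (((hDd x).pow 3).const_mul (g * η))
      (show g * η * D x ^ 3 ≠ 0 by positivity)).congr_deriv ?_
    simp only [Pi.pow_apply, Pi.mul_apply]
    field_simp
    norm_num
    ring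
  · have hx := hXpos x
    have e1 : ((β + k ^ 2) * (Real.sin (θ x) * Real.cos (θ x)) / (g * η * D x ^ 3)) ^ 2 =
        (β + k ^ 2) ^ 2 * (Real.sin (θ x) ^ 2 * Real.cos (θ x) ^ 2) /
          (g ^ 2 * η ^ 2 * (D x ^ 2) ^ 3) := by ring
    rw [e1, hD2, hcs, hb, hc4, hb2]
    rw [hβ]
    rw [hk2] at hx ⊢
    generalize Real.sin (θ x) ^ 2 = s at *
    -- An opaque positive name for the numerator of `dn²` lets denominators be cleared before it is
    -- expanded.
    obtain ⟨Z, hZ⟩ : ∃ Z, Z = η * (u - n) + n * (η - u) * s := ⟨_, rfl⟩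
    have e2 : 1 - -n * (η - u) / (η * (u - n)) * s = Z / (η * (u - n)) := by
      rw [hZ]; field_simp; ring
    rw [e2] at hx ⊢
    have hZ0 : 0 < Z := (div_pos_iff_of_pos_right (by positivity)).1 hx
    field_simp
    rw [hZ]
    ring
  · have hx := hXpos x
    have e1 : D x ^ 4 = (D x ^ 2) ^ 2 := by ring
    rw [e1, hD2, hcs, hb, hc4, hb2]
    rw [hβ]
    rw [hk2] at hx ⊢
    generalize Real.sin (θ x) ^ 2 = s at *
    obtain ⟨Z, hZ⟩ : ∃ Z, Z = η * (u - n) + n * (η - u) * s := ⟨_, rfl⟩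
    have e2 : 1 - -n * (η - u) / (η * (u - n)) * s = Z / (η * (u - n)) := by
      rw [hZ]; field_simp; ring
    rw [e2] at hx ⊢
    have hZ0 : 0 < Z := (div_pos_iff_of_pos_right (by positivity)).1 hx
    field_simp
    rw [hZ]
    ring
  · simp [hθ, jacobiAm_zero hk]
  · rw [hw, inv_div, hD2]

end PeriodicWave

/-! ### Convergence to the soliton -/

theorem IsReciprocalProfile.exists_velocity {ω c p : ℝ} {r r' r'' f : ℝ → ℝ}
    (h : IsReciprocalProfile ω c p r r' r'') (hp : 0 ≤ p) (h0 : r' 0 = 0)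
    (hf : ∀ x, f x = √((r x)⁻¹)) :
    ∃ v : ℝ → ℝ, IsNewtonSolution (waveForce ω c) f v ∧ v 0 = 0 ∧
      ∀ x, v x ^ 2 ≤ f x ^ 2 * (4 * c * f x ^ 2 + (16 * ω - 4 * c ^ 2)) / 16 := by
  obtain rfl : f = fun x => (√(r x))⁻¹ := funext fun x => by rw [hf, Real.sqrt_inv]
  exact ⟨_, h.isNewtonSolution, by simp [h0], h.velocity_sq_le hp⟩

theorem velocity_sq_le_of_sq_le {ω c f v B C t : ℝ} (hb : 0 ≤ 16 * ω - 4 * c ^ 2)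
    (hv : v ^ 2 ≤ f ^ 2 * (4 * c * f ^ 2 + (16 * ω - 4 * c ^ 2)) / 16) (hB : f ^ 2 ≤ B)
    (ht : f ^ 2 ≤ C * t) (hCt : 0 ≤ C * t) :
    f ^ 2 ≤ C * (1 + (4 * |c| * B + (16 * ω - 4 * c ^ 2)) / 16) * t ∧
      v ^ 2 ≤ C * (1 + (4 * |c| * B + (16 * ω - 4 * c ^ 2)) / 16) * t := by
  have hB0 : 0 ≤ B := (sq_nonneg f).trans hB
  set M := (4 * |c| * B + (16 * ω - 4 * c ^ 2)) / 16 with hM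
  have hM0 : 0 ≤ M := by positivity
  have h1 : (4 * c * f ^ 2 + (16 * ω - 4 * c ^ 2)) / 16 ≤ M := by
    have : c * f ^ 2 ≤ |c| * B := mul_le_mul (le_abs_self c) hB (sq_nonneg f) (abs_nonneg c)
    rw [hM]; linarith
  have h2 : v ^ 2 ≤ f ^ 2 * M := by
    refine hv.trans ?_
    rw [mul_div_assoc]
    exact mul_le_mul_of_nonneg_left h1 (sq_nonneg f)
  have h3 := mul_le_mul_of_nonneg_right ht hM0
  have h4 := mul_nonneg hCt hM0
  constructor <;> linarith

theorem tendsto_sobolevNorm_periodicWave_sub_soliton {ω c : ℝ} (h : Admissible ω c) (m : ℕ) :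
    Tendsto (fun L : ℝ => sobolevNorm m (-L) L (fun x => periodicWave ω c L x - soliton ω c x))
      atTop (𝓝 0) := by
  have hb : 0 ≤ 16 * ω - 4 * c ^ 2 := by linarith [h.sq_le]
  have hα1 : 0 < alpha1 ω c := (alpha0_pos h).trans (alpha0_lt_alpha1 h)
  obtain ⟨r, r', r'', hr, hr0, hrα, ⟨μ, hμ, hμr⟩, hsol⟩ := exists_reciprocal_soliton h
  obtain ⟨w, hw, hw0, hwle⟩ := hr.exists_velocity le_rfl hr0 (f := soliton ω c)
    fun x => by rw [soliton, hsol]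
  have hψ : ∀ x, soliton ω c x ^ 2 = (r x)⁻¹ := fun x => by
    rw [soliton, hsol, Real.sq_sqrt (inv_pos.2 (hr.pos x)).le]
  -- The condition on `L` sits inside the existential so that `choose` yields a velocity for every
  -- `L`, with a dummy value below the threshold.
  have hwave : ∀ L, ∃ v : ℝ → ℝ, thresholdL ω c < L →
      (IsNewtonSolution (waveForce ω c) (periodicWave ω c L) v ∧ v 0 = 0 ∧
        (∀ x, v x ^ 2 ≤ periodicWave ω c L x ^ 2 *
          (4 * c * periodicWave ω c L x ^ 2 + (16 * ω - 4 * c ^ 2)) / 16)) ∧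
      ∀ x, periodicWave ω c L x ^ 2 = waveSq ω c (eta3 ω c L) x := by
    intro L
    by_cases hL : thresholdL ω c < L
    · obtain ⟨a1, a2, a3⟩ := isMaxValue_eta3 h hL
      obtain ⟨p, s, s', s'', hp, hs, hs0, hs1⟩ := exists_reciprocal_wave h a1.le a2
      obtain ⟨v, hv⟩ := hs.exists_velocity hp hs0 (f := periodicWave ω c L)
        fun x => by rw [periodicWave, hs1]
      refine ⟨v, fun _ => ⟨hv, fun x => ?_⟩⟩
      rw [periodicWave, Real.sq_sqrt]
      rw [hs1]; exact (inv_pos.2 (hs.pos x)).le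
    · exact ⟨0, fun h => absurd h hL⟩
  choose v hv using hwave
  have hev := eventually_gt_atTop (thresholdL ω c)
  have hη := tendsto_eta3 h
  -- `η₃ - η₂ → α₁ - 0`, which keeps the decay constant `4π²/(η₃ - η₂)` below `8π²/α₁`.
  have hdiff : ∀ᶠ L in atTop, alpha1 ω c / 2 < eta3 ω c L - eta2 ω c (eta3 ω c L) := by
    have h1 : Tendsto (fun η => η - eta2 ω c η) (𝓝 (alpha1 ω c)) (𝓝 (alpha1 ω c - 0)) := by
      rw [← eta2_alpha1 h]
      exact (continuous_id.sub (continuous_eta2 ω c)).tendsto _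
    exact (h1.comp hη).eventually_const_lt (by linarith)
  -- `B` bounds both squared profiles and `C` bounds them times `1 + x²`: `α₁` and `8π²/α₁` serve
  -- the waves, `1/μ` the soliton.
  set B := alpha1 ω c + 1 / μ with hB
  set C := alpha1 ω c + 8 * Real.pi ^ 2 / alpha1 ω c + 1 / μ with hC
  have hC0 : 0 ≤ C := by positivity
  refine tendsto_sobolevNorm_newton_sub (contDiff_waveForce ω c) (v := v) (w := w)
    (C := C * (1 + (4 * |c| * B + (16 * ω - 4 * c ^ 2)) / 16))
    (hev.mono fun L hL => (hv L hL).1.1) hw (hev.mono fun L hL => (hv L hL).1.2.1) hw0 ?_ ?_ ?_ m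
  · have h1 : soliton ω c 0 = √(alpha1 ω c) := by rw [soliton, hsol, hrα, inv_inv]
    rw [h1]
    refine (Real.continuous_sqrt.tendsto _ |>.comp hη).congr' ?_
    filter_upwards [hev] with L hL
    obtain ⟨a1, a2, a3⟩ := isMaxValue_eta3 h hL
    rw [periodicWave, waveSq_zero h a1.le a2]; rfl
  · filter_upwards [hev, hdiff] with L hL hLd x hx
    obtain ⟨a1, a2, a3⟩ := isMaxValue_eta3 h hL
    obtain ⟨⟨-, -, hvle⟩, hsq⟩ := hv L hL
    have hle := waveSq_le h a1.le a2 x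
    have hdec := waveSq_mul_sq_le h a1 a2 (x := x) (by rw [a3]; linarith)
    have hdec2 : 4 * Real.pi ^ 2 / (eta3 ω c L - eta2 ω c (eta3 ω c L)) ≤
        8 * Real.pi ^ 2 / alpha1 ω c := by
      rw [div_le_div_iff₀ (by linarith) hα1]
      nlinarith [sq_nonneg Real.pi]
    have hμ1 : 0 < 1 / μ := by positivity
    refine velocity_sq_le_of_sq_le hb (hvle x) (by rw [hsq, hB]; linarith) ?_ (by positivity)
    rw [hsq, ← div_eq_mul_inv, le_div_iff₀ (by positivity), hC]
    linarith
  · intro x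
    have h1 : (r x)⁻¹ ≤ 1 / μ * (1 + x ^ 2)⁻¹ := by
      rw [one_div, ← mul_inv]
      exact inv_anti₀ (by positivity) (hμr x)
    have h2 : 1 / μ * (1 + x ^ 2)⁻¹ ≤ 1 / μ :=
      mul_le_of_le_one_right (by positivity) (inv_le_one_of_one_le₀ (by nlinarith))
    refine velocity_sq_le_of_sq_le hb (hwle x) (by rw [hψ, hB]; linarith) ?_ (by positivity)
    rw [hψ]
    refine h1.trans (mul_le_mul_of_nonneg_right ?_ (by positivity))
    have : 0 ≤ 8 * Real.pi ^ 2 / alpha1 ω c := by positivity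
    rw [hC]; linarith

theorem theorem1p2 (ω c : ℝ) (hωc : Admissible ω c) :
    (∀ L : ℝ, thresholdL ω c < L → ∃! η₃ : ℝ, IsMaxValue ω c L η₃) ∧
    ∀ m : ℕ,
      Tendsto (fun L : ℝ => sobolevNorm m (-L) L (fun x => periodicWave ω c L x - soliton ω c x))
        atTop (𝓝 0) :=
  ⟨fun _ hL => existsUnique_isMaxValue hωc hL,
    fun m => tendsto_sobolevNorm_periodicWave_sub_soliton hωc m⟩
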